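/- **Setting.** Let $E=\mathbb R^2$ with complex structure $J$ (rotation by $\pi/2$), let $m_1,m_2,m_3>0$, and let $\alpha\ge 1$. Let $E_{red}=\{x\in E^3:\ m_1x_1+m_2x_2+m_3x_3=0\}$ and $$U(x)=\sum_{1\le k<k'\le 3} m_km_{k'}\,\phi_\alpha(\|x_k-x_{k'}\|),\qquad \phi_1(r)=-\ln r,\quad \phi_\alpha(r)=\frac{r^{1-\alpha}}{\alpha-1}\ (\alpha\ne 1),$$ so that $\phi_\alpha'(r)=-r^{-\alpha}$. A central configuration is a collision-free $a\in E_{red}$ with $m_ka_k=\sum_{k'\ne k}m_km_{k'}\frac{a_k-a_{k'}}{\|a_k-a_{k'}\|^{\alpha+1}}$ for every $k$; a Lagrange triangle is a central configuration in which the three mutual distances are equal. For $p\in\mathbb Z\setminus\{0\}$ and $S^1=\mathbb R/2\pi\mathbb Z$ consider on $H^1(S^1,E_{red})$ the action $$A_p(u)=\int_0^{2\pi}\Big(\frac12\sum_{k=1}^3 m_k\Big\|\frac1p\,\dot u_k(s)+Ju_k(s)\Big\|^2+U(u(s))\Big)\,ds .$$ For a functional $f$ on a Sobolev space containing the constant paths,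 the orbit $\{e^{\theta J}a:\theta\in\mathbb R\}$ (viewed as a set of constant paths) is a nondegenerate critical manifold of $f$ if, at every point $b$ of the orbit, $f$ is $C^2$ near $b$, $b$ is a critical point of $f$, and the kernel of the Hessian of $f$ at $b$ is $\mathrm{span}(Jb)$. The configuration $a$ is called $2\pi p$-nondegenerate if its orbit is a nondegenerate critical manifold of $A_p$ on $H^1(S^1,E_{red})$. It is called $2\pi/l$-nondegenerate (for an integer $l\ge1$) if its orbit is a nondegenerate critical manifold of $A_1$ restricted to the subspace of $2\pi/l$-periodic paths in $H^1(S^1,E_{red})$. **Statement.** Put $\beta=27\,\dfrac{m_1m_2+m_1m_3+m_2m_3}{(m_1+m_2+m_3)^2}$. 1. Suppose that $\alpha\ge1$, $\alpha\neq2$ and $\beta>9\left(\dfrac{3-\alpha}{1+\alpha}\right)^2$. Let $p$ be a nonzero integer such that, in case $\alpha<3$, $|p|\notin(3-\alpha)^{-1/2}\mathbb N$ (for $\alpha\ge 3$ no condition on $p$ is needed). Then every Lagrange triangle with masses $m_1,m_2,m_3$ is $2\pi p$-nondegenerate. 2. Suppose that $\alpha=2$ and $\beta>1$. Then every Lagrange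 triangle with masses $m_1,m_2,m_3$ is $2\pi/l$-nondegenerate for every integer $l>1$. -/

import Mathlib

open MeasureTheory Set Filter Topology
open scoped ContDiff Real

noncomputable section

/-! ### The Sobolev space `H¹(S¹, F)` of `2π`-periodic paths -/

namespace Sobolev

instance instFactTwoPiPos : Fact (0 < 2 * π) := ⟨Real.two_pi_pos⟩

/-- The circle `S¹ = ℝ / 2πℤ`; its `volume` has total mass `2π`. -/
abbrev S1 : Type := AddCircle (2 * π)

variable {F : Type*} [NormedAddCommGroup F] [NormedSpace ℝ F]

/-- `v` is the derivative of `u` on the circle in the sense of distributions: for every smooth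
test function `φ` on `S¹` with derivative `ψ = φ'`, one has `∫ φ' u = - ∫ φ v`. -/
def IsWeakDeriv (u v : S1 → F) : Prop :=
  ∀ φ ψ : S1 → ℝ, ContDiff ℝ ∞ (fun t : ℝ => φ (t : S1)) →
    (∀ t : ℝ, HasDerivAt (fun x : ℝ => φ (x : S1)) (ψ (t : S1)) t) →
    ∫ s, ψ s • u s = - ∫ s, φ s • v s

theorem continuous_of_lift {φ : S1 → ℝ} (h : Continuous fun t : ℝ => φ (t : S1)) :
    Continuous φ :=
  (QuotientAddGroup.isOpenQuotientMap_mk.isQuotientMap).continuous_iff.mpr h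

theorem continuous_deriv {φ ψ : S1 → ℝ} (h : ContDiff ℝ ∞ (fun t : ℝ => φ (t : S1)))
    (hψ : ∀ t : ℝ, HasDerivAt (fun x : ℝ => φ (x : S1)) (ψ (t : S1)) t) : Continuous ψ := by
  apply continuous_of_lift
  have : (fun t : ℝ => ψ (t : S1)) = deriv (fun t : ℝ => φ (t : S1)) := by
    funext t; exact (hψ t).deriv.symm
  rw [this]
  exact h.continuous_deriv (by simp)

theorem integrable_smul {φ : S1 → ℝ} (h : Continuous φ) (u : Lp F 2 (volume : Measure S1)) :
    Integrable (fun s => φ s • u s) := by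
  obtain ⟨C, hC⟩ := isCompact_univ.exists_bound_of_continuousOn h.continuousOn
  exact ((Lp.memLp u).integrable (by norm_num)).bdd_smul C h.aestronglyMeasurable
    (ae_of_all _ fun s => hC s (mem_univ s))

theorem integral_deriv_eq_zero {φ ψ : S1 → ℝ}
    (h : ContDiff ℝ ∞ (fun t : ℝ => φ (t : S1)))
    (hψ : ∀ t : ℝ, HasDerivAt (fun x : ℝ => φ (x : S1)) (ψ (t : S1)) t) : ∫ s, ψ s = 0 := by
  rw [← AddCircle.intervalIntegral_preimage (2 * π) 0 ψ]
  rw [intervalIntegral.integral_eq_sub_of_hasDerivAt (fun t _ => hψ t)]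
  · rw [zero_add, AddCircle.coe_period, AddCircle.coe_zero, sub_self]
  · exact ((continuous_deriv h hψ).comp (AddCircle.continuous_mk' _)).intervalIntegrable _ _

variable (F) in
/-- The Sobolev space `H¹(S¹, F)` as a subspace of `L² × L²`: pairs `(u, u̇)` of square integrable functions on the circle such
that `u̇` is the derivative of `u` in the sense of distributions. It carries the norm
`‖u‖² = ∫ |u|² + ∫ |u̇|²`. -/
def H1submodule : Submodule ℝ
    (WithLp 2 (Lp F 2 (volume : Measure S1) × Lp F 2 (volume : Measure S1))) where
  carrier := {w | IsWeakDeriv w.fst w.snd}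
  zero_mem' := by
    intro φ ψ h hψ
    have h0 : (((0 : Lp F 2 (volume : Measure S1)) : S1 → F)) =ᵐ[volume] 0 := Lp.coeFn_zero _ _ _
    rw [integral_eq_zero_of_ae, integral_eq_zero_of_ae, neg_zero]
    · filter_upwards [h0] with s hs
      simp
    · filter_upwards [h0] with s hs
      simp
  add_mem' := by
    intro a b ha hb φ ψ h hψ
    have hφc : Continuous φ := continuous_of_lift h.continuous
    have hψc := continuous_deriv h hψ
    have e1 : ∫ s, ψ s • (a + b).fst s = ∫ s, (ψ s • a.fst s + ψ s • b.fst s) := by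
      apply integral_congr_ae
      filter_upwards [Lp.coeFn_add a.fst b.fst] with s hs
      rw [WithLp.add_fst, hs, Pi.add_apply, smul_add]
    have e2 : ∫ s, φ s • (a + b).snd s = ∫ s, (φ s • a.snd s + φ s • b.snd s) := by
      apply integral_congr_ae
      filter_upwards [Lp.coeFn_add a.snd b.snd] with s hs
      rw [WithLp.add_snd, hs, Pi.add_apply, smul_add]
    rw [e1, e2, integral_add (integrable_smul hψc _) (integrable_smul hψc _),
      integral_add (integrable_smul hφc _) (integrable_smul hφc _), ha φ ψ h hψ, hb φ ψ h hψ]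
    abel
  smul_mem' := by
    intro c a ha φ ψ h hψ
    have e1 : ∫ s, ψ s • (c • a).fst s = ∫ s, c • (ψ s • a.fst s) := by
      apply integral_congr_ae
      filter_upwards [Lp.coeFn_smul c a.fst] with s hs
      rw [WithLp.smul_fst, hs, Pi.smul_apply, smul_comm]
    have e2 : ∫ s, φ s • (c • a).snd s = ∫ s, c • (φ s • a.snd s) := by
      apply integral_congr_ae
      filter_upwards [Lp.coeFn_smul c a.snd] with s hs
      rw [WithLp.smul_snd, hs, Pi.smul_apply, smul_comm]
    rw [e1, e2, integral_smul, integral_smul, ha φ ψ h hψ, smul_neg]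

variable (F) in
/-- The Sobolev space `H¹(S¹, F)` as a normed space. -/
def H1 : Type _ := H1submodule F

instance : NormedAddCommGroup (H1 F) := inferInstanceAs (NormedAddCommGroup (H1submodule F))

instance : NormedSpace ℝ (H1 F) := inferInstanceAs (NormedSpace ℝ (H1submodule F))

/-- The path `u` underlying an element of `H¹(S¹, F)`. -/
def path (w : H1 F) : S1 → F := w.1.fst

/-- The weak derivative `u̇` of an element of `H¹(S¹, F)`. -/
def vel (w : H1 F) : S1 → F := w.1.snd

/-- The constant path `s ↦ a`, as an element of `H¹(S¹, F)`. -/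
def constPath [CompleteSpace F] (a : F) : H1 F :=
  ⟨WithLp.toLp 2 (Lp.const 2 volume a, 0), by
    intro φ ψ h hψ
    have e1 : ∫ s, ψ s • (Lp.const 2 (volume : Measure S1) a) s = ∫ s, ψ s • a := by
      apply integral_congr_ae
      filter_upwards [Lp.coeFn_const (p := 2) (μ := (volume : Measure S1)) a] with s hs
      rw [hs, Function.const_apply]
    have e2 : ∫ s, φ s • (0 : Lp F 2 (volume : Measure S1)) s = 0 := by
      apply integral_eq_zero_of_ae
      filter_upwards [Lp.coeFn_zero F 2 (volume : Measure S1)] with s hs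
      simp
    change ∫ s, ψ s • (Lp.const 2 (volume : Measure S1) a) s
      = -∫ s, φ s • (0 : Lp F 2 (volume : Measure S1)) s
    rw [e1, e2, integral_smul_const, integral_deriv_eq_zero h hψ, zero_smul, neg_zero]⟩

variable (F) in
/-- The subspace of `H¹(S¹, F)` of all `2π/m`-periodic paths. -/
def H1periodic (m : ℕ) : Submodule ℝ (H1 F) where
  carrier := {w | (fun s => path w (s + ((2 * π / m : ℝ) : S1))) =ᵐ[volume] path w}
  zero_mem' := by
    have h0 : (path (0 : H1 F)) =ᵐ[volume] 0 := Lp.coeFn_zero _ _ _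
    have h1 := (measurePreserving_add_right (volume : Measure S1)
      ((2 * π / m : ℝ) : S1)).quasiMeasurePreserving.ae_eq_comp h0
    exact h1.trans h0.symm
  add_mem' := by
    intro a b ha hb
    have h0 : (path (a + b)) =ᵐ[volume] path a + path b := Lp.coeFn_add _ _
    have h1 := (measurePreserving_add_right (volume : Measure S1)
      ((2 * π / m : ℝ) : S1)).quasiMeasurePreserving.ae_eq_comp h0
    have ha' : (fun s => path a (s + ((2 * π / m : ℝ) : S1))) =ᵐ[volume] path a := ha
    have hb' : (fun s => path b (s + ((2 * π / m : ℝ) : S1))) =ᵐ[volume] path b := hb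
    exact h1.trans ((ha'.add hb').trans h0.symm)
  smul_mem' := by
    intro c a ha
    have h0 : (path (c • a)) =ᵐ[volume] c • path a := Lp.coeFn_smul _ _
    have h1 := (measurePreserving_add_right (volume : Measure S1)
      ((2 * π / m : ℝ) : S1)).quasiMeasurePreserving.ae_eq_comp h0
    have ha' : (fun s => path a (s + ((2 * π / m : ℝ) : S1))) =ᵐ[volume] path a := ha
    exact h1.trans ((ha'.const_smul c).trans h0.symm)

theorem constPath_mem_H1periodic [CompleteSpace F] (m : ℕ) (a : F) :
    constPath a ∈ H1periodic F m := by
  have h0 : (path (constPath a)) =ᵐ[volume] Function.const S1 a :=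
    Lp.coeFn_const (p := 2) (μ := (volume : Measure S1)) a
  have h1 := (measurePreserving_add_right (volume : Measure S1)
    ((2 * π / m : ℝ) : S1)).quasiMeasurePreserving.ae_eq_comp h0
  exact h1.trans h0.symm

end Sobolev

/-! ### The planar `n`-body problem in a rotating frame -/

namespace NBody

open Sobolev

variable {n : ℕ}

/-- The space of planar configurations of `n` bodies with masses `m k` and center of mass at the
origin. The plane is `ℂ`, and its complex structure `J` is multiplication by `Complex.I`. -/
def reducedSubmodule (m : Fin n → ℝ) : Submodule ℝ (PiLp 2 (fun _ : Fin n => ℂ)) where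
  carrier := {x | ∑ k, (m k : ℂ) * x k = 0}
  zero_mem' := by simp
  add_mem' := by
    intro a b ha hb
    simp only [mem_ofPred_eq] at ha hb ⊢
    simp [mul_add, Finset.sum_add_distrib, ha, hb]
  smul_mem' := by
    intro c a ha
    simp only [mem_ofPred_eq] at ha ⊢
    simp [mul_left_comm _ (c : ℂ), ← Finset.mul_sum, ha]

/-- The space `E_red` of configurations with center of mass at the origin, as a real inner product
space. -/
def Reduced (m : Fin n → ℝ) : Type := reducedSubmodule m

instance (m : Fin n → ℝ) : NormedAddCommGroup (Reduced m) :=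
  inferInstanceAs (NormedAddCommGroup (reducedSubmodule m))

instance (m : Fin n → ℝ) : InnerProductSpace ℝ (Reduced m) :=
  inferInstanceAs (InnerProductSpace ℝ (reducedSubmodule m))

instance (m : Fin n → ℝ) : FiniteDimensional ℝ (Reduced m) :=
  inferInstanceAs (FiniteDimensional ℝ (reducedSubmodule m))

instance (m : Fin n → ℝ) : CompleteSpace (Reduced m) := FiniteDimensional.complete ℝ _

/-- The configuration underlying an element of `E_red`. -/
def Reduced.config {m : Fin n → ℝ} (a : Reduced m) : PiLp 2 (fun _ : Fin n => ℂ) :=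
  Subtype.val a

/-- Multiplication of all positions of a configuration by the complex number `c`. The map `J` is
`mul Complex.I`, and the rotation `exp(θJ)` is `mul (Complex.exp (θ * Complex.I))`. -/
def mul {m : Fin n → ℝ} (c : ℂ) (a : Reduced m) : Reduced m :=
  ⟨WithLp.toLp 2 (fun k => c * a.config k), by
    have ha : ∑ k, (m k : ℂ) * a.config k = 0 := a.2
    change ∑ k, (m k : ℂ) * (c * a.config k) = 0
    simp [mul_left_comm _ c, ← Finset.mul_sum, ha]⟩

/-- The pair potential `φ_α`, with `φ_α'(r) = - r ^ (-α)` for `r > 0`. -/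
def pairPotential (α r : ℝ) : ℝ :=
  if α = 1 then - Real.log r else r ^ (1 - α) / (α - 1)

/-- The potential function `U(x) = ∑_{k < k'} m_k m_{k'} φ_α(‖x_k - x_{k'}‖)`. -/
def potential (m : Fin n → ℝ) (α : ℝ) (x : PiLp 2 (fun _ : Fin n => ℂ)) : ℝ :=
  ∑ k, ∑ k' ∈ Finset.Ioi k, m k * m k' * pairPotential α ‖x k - x k'‖

/-- The Lagrangian `L(x, y) = ½ ‖M^{1/2} ((1/p) y + J x)‖² + U(x)`. -/
def lagrangian (m : Fin n → ℝ) (α : ℝ) (p : ℤ) (x y : PiLp 2 (fun _ : Fin n => ℂ)) : ℝ :=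
  1 / 2 * ∑ k, m k * ‖((1 / p : ℝ) : ℂ) * y k + Complex.I * x k‖ ^ 2 + potential m α x

/-- The action `A(u) = ∫_0^{2π} L(u, u̇) ds` on `H¹(S¹, E_red)`. -/
def action (m : Fin n → ℝ) (α : ℝ) (p : ℤ) (u : H1 (Reduced m)) : ℝ :=
  ∫ s, lagrangian m α p (path u s).config (vel u s).config

/-- A central configuration (of frequency one): a collision-free configuration with center of mass
at the origin such that `m_k a_k = ∑_{k' ≠ k} m_k m_{k'} (a_k - a_{k'}) / ‖a_k - a_{k'}‖^{α+1}`. -/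
def IsCentralConfiguration (m : Fin n → ℝ) (α : ℝ) (a : Reduced m) : Prop :=
  Function.Injective (fun k => a.config k) ∧
    ∀ k, (m k : ℂ) * a.config k = ∑ k' ∈ Finset.univ.erase k,
      ((m k * m k' / ‖a.config k - a.config k'‖ ^ (α + 1) : ℝ) : ℂ) * (a.config k - a.config k')

/-- A Lagrange triangle: an equilateral central configuration of three bodies. -/
def IsLagrangeTriangle (m : Fin 3 → ℝ) (α : ℝ) (a : Reduced m) : Prop :=
  IsCentralConfiguration m α a ∧ ∃ d : ℝ, 0 < d ∧ ∀ i j, i ≠ j → ‖a.config i - a.config j‖ = d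

/-- `x` is a critical point of `f`, near which `f` is of class `C²`, and the kernel of the Hessian
of `f` at `x` (a continuous bilinear form, given as a map to the dual space) is `T`. -/
def IsCriticalWithHessianKernel {X : Type*} [NormedAddCommGroup X] [NormedSpace ℝ X]
    (f : X → ℝ) (x : X) (T : Submodule ℝ X) : Prop :=
  ContDiffAt ℝ 2 f x ∧ fderiv ℝ f x = 0 ∧
    LinearMap.ker (fderiv ℝ (fderiv ℝ f) x : X →ₗ[ℝ] (X →L[ℝ] ℝ)) = T

/-- `a` is `2πp`-nondegenerate: its orbit `{e^{θJ} a}` is a nondegenerate critical manifold of the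
action in `H¹(S¹, E_red)`, i.e. at every point `b` of the orbit the kernel of the Hessian is
the tangent line `span (J b)`. -/
def IsTwoPiNondegenerate (m : Fin n → ℝ) (α : ℝ) (p : ℤ) (a : Reduced m) : Prop :=
  ∀ θ : ℝ, ∀ b : Reduced m, b = mul (Complex.exp (θ * Complex.I)) a →
    IsCriticalWithHessianKernel (action m α p) (constPath b)
      (Submodule.span ℝ {constPath (mul Complex.I b)})

/-- `a` is `2π/l`-nondegenerate: its orbit is a nondegenerate critical manifold of the action
(with `p = 1`) restricted to the space of `2π/l`-periodic paths in `H¹(S¹, E_red)`. -/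
def IsTwoPiDivNondegenerate (m : Fin n → ℝ) (α : ℝ) (l : ℕ) (a : Reduced m) : Prop :=
  ∀ θ : ℝ, ∀ b : Reduced m, b = mul (Complex.exp (θ * Complex.I)) a →
    IsCriticalWithHessianKernel (fun u : H1periodic (Reduced m) l => action m α 1 u.1)
      ⟨constPath b, constPath_mem_H1periodic l b⟩
      (Submodule.span ℝ {⟨constPath (mul Complex.I b), constPath_mem_H1periodic l _⟩})

end NBody

end

/-! At a constant path `b` the second variation of the action has constant coefficients, so testing
it against `cos (n s) w` and `sin (n s) w` separates the Fourier modes. With `ν = n / p` and `c`,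
`s` the cosine and sine integrals of a kernel element, the equations are `(ν² + 1) c - 2 ν J s + M⁻¹
D²U(b) c = 0`, where `M` is the mass matrix, and its partner with `c`, `s` exchanged and `ν`
negated.

For an equilateral triangle of side `d` the central configuration equation forces `d ^ (α + 1)` to
be the total mass (`rpow_side`). Dividing the differences of positions by one side, the three sides
become `1, ζ, ζ²` with `ζ` a primitive cube root of unity, and with `γ = (α + 1) / 2` the system
splits in two (`fourierMode_differences`): - the component `C0 + ζ C1 + ζ² C2`, which vanishes
exactly on homographic deformations, obeys a system with determinant `(ν² + γ)² - 4ν² - γ²(1 - β/9)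
= (ν² + γ - 2)² + γ²β/9 - (γ - 2)²`. The hypothesis on `β` makes it positive for every `ν`, so this
component is zero; - the homographic part is a linearized Kepler problem. For `ν ≠ 0` it has a
nonzero solution only if `ν² = 4 - 2γ = 3 - α`; for `ν = 0` only the rotation `J b` survives.

Hence the kernel is spanned by `J b` as soon as no admissible nonzero `n` has `(n / p)² = 3 - α`.
The condition on `p` ensures this in the first statement. For `α = 2`, `p = 1` the resonances are `n
= ±1`, which are not multiples of `l > 1` and so do not occur among `2π/l`-periodic paths.
`IsLagrangeTriangle.isCriticalWithHessianKernel` treats both spaces at once through an injection `ι`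
into `H1` and a set `modes` of admissible frequencies.

Smoothness: the kinetic term is quadratic in bounded maps to `L²`. For the potential, `H¹` embeds in
the continuous paths, where superposition with a `C²` function is `C²`; since `U` is singular at
collisions, it is first cut off near `b` (`hasHessianAt_action`). -/

noncomputable section

/-! ### Functions with prescribed first and second derivative at a point -/

section Hessian

variable {X Y : Type*} [NormedAddCommGroup X] [NormedSpace ℝ X] [NormedAddCommGroup Y]
  [NormedSpace ℝ Y]

/-- `f` is `C²` near `x`, with derivative `f'` and Hessian `B` at `x`. -/
structure HasHessianAt (f : X → ℝ) (f' : X →L[ℝ] ℝ) (B : X →L[ℝ] X →L[ℝ] ℝ) (x : X) :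
    Prop where
  contDiffAt : ContDiffAt ℝ 2 f x
  fderiv_eq : fderiv ℝ f x = f'
  fderiv_fderiv_eq : fderiv ℝ (fderiv ℝ f) x = B

namespace HasHessianAt

variable {f g : X → ℝ} {f' g' : X →L[ℝ] ℝ} {B C : X →L[ℝ] X →L[ℝ] ℝ} {x : X}

theorem eventually_differentiableAt (hf : ContDiffAt ℝ 2 f x) :
    ∀ᶠ y in 𝓝 x, DifferentiableAt ℝ f y := by
  filter_upwards [hf.eventually (by simp)] with y hy
  exact hy.differentiableAt (by norm_num)

theorem differentiableAt_fderiv (hf : ContDiffAt ℝ 2 f x) :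
    DifferentiableAt ℝ (fderiv ℝ f) x :=
  (hf.fderiv_right (m := 1) (by norm_num)).differentiableAt (by norm_num)

theorem of_hasFDerivAt {F' : X → X →L[ℝ] ℝ} (hf : ContDiffAt ℝ 2 f x)
    (h1 : ∀ᶠ y in 𝓝 x, HasFDerivAt f (F' y) y) (h2 : HasFDerivAt F' B x) :
    HasHessianAt f (F' x) B x where
  contDiffAt := hf
  fderiv_eq := h1.self_of_nhds.fderiv
  fderiv_fderiv_eq := by
    have : fderiv ℝ f =ᶠ[𝓝 x] F' := h1.mono fun y hy => hy.fderiv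
    rw [this.fderiv_eq, h2.fderiv]

theorem congr (hf : HasHessianAt f f' B x) (h : g =ᶠ[𝓝 x] f) : HasHessianAt g f' B x where
  contDiffAt := hf.contDiffAt.congr_of_eventuallyEq h
  fderiv_eq := by rw [h.fderiv_eq, hf.fderiv_eq]
  fderiv_fderiv_eq := by rw [h.fderiv.fderiv_eq, hf.fderiv_fderiv_eq]

theorem add (hf : HasHessianAt f f' B x) (hg : HasHessianAt g g' C x) :
    HasHessianAt (fun y => f y + g y) (f' + g') (B + C) x := by
  have := of_hasFDerivAt (F' := fun y => fderiv ℝ f y + fderiv ℝ g y) (B := B + C)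
    (hf.contDiffAt.add hg.contDiffAt) ?_ ?_
  · simpa only [hf.fderiv_eq, hg.fderiv_eq] using this
  · filter_upwards [eventually_differentiableAt hf.contDiffAt,
      eventually_differentiableAt hg.contDiffAt] with y h1 h2
    exact h1.hasFDerivAt.add h2.hasFDerivAt
  · rw [← hf.fderiv_fderiv_eq, ← hg.fderiv_fderiv_eq]
    exact (differentiableAt_fderiv hf.contDiffAt).hasFDerivAt.add
      (differentiableAt_fderiv hg.contDiffAt).hasFDerivAt

theorem const_mul (c : ℝ) (hf : HasHessianAt f f' B x) :
    HasHessianAt (fun y => c * f y) (c • f') (c • B) x := by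
  have := of_hasFDerivAt (f := fun y => c * f y) (F' := fun y => c • fderiv ℝ f y) (B := c • B)
    (contDiffAt_const.mul hf.contDiffAt) ?_ ?_
  · simpa only [hf.fderiv_eq] using this
  · filter_upwards [eventually_differentiableAt hf.contDiffAt] with y h1
    exact h1.hasFDerivAt.const_mul c
  · rw [← hf.fderiv_fderiv_eq]
    exact (differentiableAt_fderiv hf.contDiffAt).hasFDerivAt.const_smul c

theorem zero : HasHessianAt (fun _ : X => (0 : ℝ)) 0 0 x where
  contDiffAt := contDiffAt_const
  fderiv_eq := by simp
  fderiv_fderiv_eq := by simp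

theorem sum {ι : Type*} (s : Finset ι) {f : ι → X → ℝ} {f' : ι → X →L[ℝ] ℝ}
    {B : ι → X →L[ℝ] X →L[ℝ] ℝ} (h : ∀ i ∈ s, HasHessianAt (f i) (f' i) (B i) x) :
    HasHessianAt (fun y => ∑ i ∈ s, f i y) (∑ i ∈ s, f' i) (∑ i ∈ s, B i) x := by
  classical
  induction s using Finset.induction_on with
  | empty => simpa using zero
  | insert i s hi ih =>
    simp only [Finset.sum_insert hi]
    exact (h i (by simp)).add (ih fun j hj => h j (by simp [hj]))

theorem comp_clm (L : Y →L[ℝ] X) {y : Y} (hf : HasHessianAt f f' B (L y)) :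
    HasHessianAt (fun z => f (L z)) (f'.comp L)
      ((ContinuousLinearMap.precomp ℝ L).comp (B.comp L)) y := by
  have := of_hasFDerivAt (f := fun z => f (L z)) (x := y) (F' := fun z => (fderiv ℝ f (L z)).comp L)
    (B := (ContinuousLinearMap.precomp ℝ L).comp (B.comp L))
    (hf.contDiffAt.comp y L.contDiff.contDiffAt) ?_ ?_
  · simpa only [hf.fderiv_eq] using this
  · filter_upwards [L.continuous.continuousAt.eventually
      (eventually_differentiableAt hf.contDiffAt)] with z h1
    exact h1.hasFDerivAt.comp z L.hasFDerivAt
  · rw [← hf.fderiv_fderiv_eq]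
    exact (ContinuousLinearMap.precomp ℝ L).hasFDerivAt.comp y
      ((differentiableAt_fderiv hf.contDiffAt).hasFDerivAt.comp y L.hasFDerivAt)

/-- Half the squared norm of an inner product space. -/
theorem half_norm_sq {H : Type*} [NormedAddCommGroup H] [InnerProductSpace ℝ H] (x : H) :
    HasHessianAt (fun y : H => 1 / 2 * ‖y‖ ^ 2) (innerSL ℝ x) (innerSL ℝ) x := by
  refine of_hasFDerivAt (F' := fun y => innerSL ℝ y) ?_ ?_ (innerSL ℝ).hasFDerivAt
  · exact (contDiff_const.mul (contDiff_norm_sq ℝ)).contDiffAt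
  · refine Eventually.of_forall fun y => ?_
    have := ((hasStrictFDerivAt_norm_sq y).hasFDerivAt).const_mul (1 / 2 : ℝ)
    refine this.congr_fderiv ?_
    ext z
    simp

end HasHessianAt

end Hessian

/-! ### Superposition operators on spaces of continuous functions -/

section Superposition

variable {K : Type} [TopologicalSpace K] [CompactSpace K]
  {F G : Type} [NormedAddCommGroup F] [NormedSpace ℝ F] [NormedAddCommGroup G] [NormedSpace ℝ G]

/-- Pointwise evaluation of a continuous family of operators on a continuous function. -/
def pointwiseApply : C(K, F →L[ℝ] G) →L[ℝ] C(K, F) →L[ℝ] C(K, G) :=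
  LinearMap.mkContinuous₂
    (LinearMap.mk₂ ℝ (fun (l : C(K, F →L[ℝ] G)) (h : C(K, F)) =>
        (⟨fun s => l s (h s), l.continuous.clm_apply h.continuous⟩ : C(K, G)))
      (fun _ _ _ => by ext; simp) (fun _ _ _ => by ext; simp)
      (fun _ _ _ => by ext; simp) (fun _ _ _ => by ext; simp)) 1
    (fun l h => by
      rw [one_mul]
      refine (ContinuousMap.norm_le _ (by positivity)).2 fun s => ?_
      exact (l s).le_of_opNorm_le_of_le (l.norm_coe_le_norm s) (h.norm_coe_le_norm s))

/-- The mean value inequality bounds the remainder at each point; the bound is uniform because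
`fderiv ℝ g` is uniformly continuous around the compact range of `u`. -/
theorem hasFDerivAt_comp_continuousMap {g : F → G} (hg : ContDiff ℝ 1 g) (u : C(K, F)) :
    HasFDerivAt (fun v : C(K, F) => (ContinuousMap.mk g hg.continuous).comp v)
      (pointwiseApply ((ContinuousMap.mk (fderiv ℝ g) (hg.continuous_fderiv one_ne_zero)).comp u))
          u := by
  rw [hasFDerivAt_iff_isLittleO, Asymptotics.isLittleO_iff]
  intro ε hε
  have hc : Continuous (fderiv ℝ g) := hg.continuous_fderiv one_ne_zero
  have huc := (isCompact_range u.continuous).uniformContinuousAt_of_continuousAt (fderiv ℝ g)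
    (fun _ _ => hc.continuousAt) (Metric.dist_mem_uniformity hε)
  obtain ⟨δ, hδ, h⟩ := Metric.mem_uniformity_dist.1 huc
  filter_upwards [Metric.ball_mem_nhds u hδ] with v hv
  rw [Metric.mem_ball] at hv
  refine (ContinuousMap.norm_le _ (by positivity)).2 fun s => ?_
  have hvs : dist (v s) (u s) < δ := (ContinuousMap.dist_apply_le_dist s).trans_lt hv
  have key := (convex_ball (u s) δ).norm_image_sub_le_of_norm_hasFDerivWithin_le'
    (f := g) (f' := fun y => fderiv ℝ g y) (φ := fderiv ℝ g (u s)) (C := ε) (x := u s) (y := v s)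
    (fun y _ => (hg.differentiable one_ne_zero y).hasFDerivAt.hasFDerivWithinAt)
    (fun y hy => by
      rw [← dist_eq_norm, dist_comm]
      refine (h (a := u s) (b := y) ?_ (mem_range_self s)).le
      rw [dist_comm]
      exact hy) (Metric.mem_ball_self hδ) hvs
  calc _ ≤ ε * ‖v s - u s‖ := key
    _ ≤ ε * ‖v - u‖ := by gcongr; exact (v - u).norm_coe_le_norm s

/-- The derivative is again a superposition operator, with `fderiv ℝ g` in place of `g`, followed by
the bounded map `pointwiseApply`. The codomain is quantified inside the induction because it changes
from `G` to `F →L[ℝ] G`. -/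
theorem contDiff_comp_continuousMap (n : ℕ) : ∀ {G : Type} [NormedAddCommGroup G]
    [NormedSpace ℝ G] {g : F → G} (_ : ContDiff ℝ n g) (hc : Continuous g),
    ContDiff ℝ n (fun v : C(K, F) => (ContinuousMap.mk g hc).comp v) := by
  induction n with
  | zero =>
    intro G _ _ g hg hc
    exact contDiff_zero.2 (ContinuousMap.continuous_postcomp _)
  | succ n ih =>
    intro G _ _ g hg hc
    have h1 : ContDiff ℝ 1 g := hg.of_le (by exact_mod_cast Nat.le_add_left 1 n)
    have hg' : ContDiff ℝ n (fderiv ℝ g) := hg.fderiv_right (by norm_cast)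
    rw [show ((n + 1 : ℕ) : WithTop ℕ∞) = (n : WithTop ℕ∞) + 1 by norm_cast,
      contDiff_succ_iff_hasFDerivAt]
    · have h := (pointwiseApply (K := K) (F := F) (G := G)).contDiff.comp (ih hg' hg'.continuous)
      exact ⟨_, h, fun u => hasFDerivAt_comp_continuousMap h1 u⟩

variable [MeasurableSpace K] [BorelSpace K] (μ : Measure K) [IsFiniteMeasure μ]

theorem ContinuousMap.integrable_of_isFiniteMeasure {E : Type*} [NormedAddCommGroup E]
    (f : C(K, E)) : Integrable f μ :=
  f.continuous.integrable_of_hasCompactSupport (HasCompactSupport.of_compactSpace _)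

/-- Integration as a continuous linear functional on continuous functions. -/
def integralContinuousMap : C(K, ℝ) →L[ℝ] ℝ :=
  LinearMap.mkContinuous
    { toFun := fun f => ∫ s, f s ∂μ
      map_add' := fun f g => integral_add (f.integrable_of_isFiniteMeasure μ)
        (g.integrable_of_isFiniteMeasure μ)
      map_smul' := fun c f => integral_smul c f } (μ.real univ)
    (fun f => by
      rw [mul_comm]
      exact norm_integral_le_of_norm_le_const (ae_of_all _ fun s => f.norm_coe_le_norm s))

theorem hasHessianAt_integral_comp {g : F → ℝ} (hg : ContDiff ℝ 2 g) (u : C(K, F)) :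
    ∃ N' B, HasHessianAt (fun v : C(K, F) => ∫ s, g (v s) ∂μ) N' B u ∧
      (∀ h, N' h = ∫ s, fderiv ℝ g (u s) (h s) ∂μ) ∧
      ∀ h k, B h k = ∫ s, fderiv ℝ (fderiv ℝ g) (u s) (h s) (k s) ∂μ := by
  have h1 : ContDiff ℝ 1 g := hg.of_le (by norm_num)
  have h2 : ContDiff ℝ 1 (fderiv ℝ g) := hg.fderiv_right (by norm_num)
  set I := integralContinuousMap μ
  have e : (fun v : C(K, F) => ∫ s, g (v s) ∂μ) =
    fun v => I ((ContinuousMap.mk g hg.continuous).comp v) := rfl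
  refine ⟨_, _, HasHessianAt.of_hasFDerivAt (x := u)
    (F' := fun v => I.comp
      (pointwiseApply ((ContinuousMap.mk (fderiv ℝ g) h2.continuous).comp v)))
    (B := (ContinuousLinearMap.postcomp (C(K, F)) I).comp (pointwiseApply.comp
      (pointwiseApply ((ContinuousMap.mk (fderiv ℝ (fderiv ℝ g))
        (h2.continuous_fderiv one_ne_zero)).comp u)))) ?_
    (Eventually.of_forall fun v => ?_) ?_, ?_, ?_⟩
  · rw [e]
    exact (I.contDiff.comp (contDiff_comp_continuousMap 2 hg hg.continuous)).contDiffAt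
  · exact I.hasFDerivAt.comp v (hasFDerivAt_comp_continuousMap h1 v)
  · exact ((ContinuousLinearMap.postcomp (C(K, F)) I).comp pointwiseApply).hasFDerivAt.comp u
      (hasFDerivAt_comp_continuousMap h2 u)
  · intro h
    rfl
  · intro h k
    rfl

end Superposition

namespace Sobolev

/-! ### Fourier coefficients of paths -/

/-- The function `s ↦ cos (n s)` on the circle. -/
def cosS (n : ℤ) (s : S1) : ℝ := (fourier n s).re

/-- The function `s ↦ sin (n s)` on the circle. -/
def sinS (n : ℤ) (s : S1) : ℝ := (fourier n s).im

theorem fourier_coe_eq (n : ℤ) (t : ℝ) :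
    fourier n (t : S1) = Complex.exp ((n * t : ℝ) * Complex.I) := by
  rw [fourier_coe_apply]
  congr 1
  have : (π : ℂ) ≠ 0 := by exact_mod_cast Real.pi_ne_zero
  push_cast
  field_simp

theorem cosS_coe (n : ℤ) (t : ℝ) : cosS n (t : S1) = Real.cos (n * t) := by
  rw [cosS, fourier_coe_eq, Complex.exp_ofReal_mul_I_re]

theorem sinS_coe (n : ℤ) (t : ℝ) : sinS n (t : S1) = Real.sin (n * t) := by
  rw [sinS, fourier_coe_eq, Complex.exp_ofReal_mul_I_im]

theorem contDiff_cosS (n : ℤ) : ContDiff ℝ ∞ (fun t : ℝ => cosS n (t : S1)) := by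
  simp only [cosS_coe]
  fun_prop

theorem contDiff_sinS (n : ℤ) : ContDiff ℝ ∞ (fun t : ℝ => sinS n (t : S1)) := by
  simp only [sinS_coe]
  fun_prop

theorem hasDerivAt_cosS (n : ℤ) (t : ℝ) :
    HasDerivAt (fun x : ℝ => cosS n (x : S1)) (-n * sinS n (t : S1)) t := by
  simp only [cosS_coe, sinS_coe]
  exact ((hasDerivAt_id' t).const_mul (n : ℝ)).cos.congr_deriv (by ring)

theorem hasDerivAt_sinS (n : ℤ) (t : ℝ) :
    HasDerivAt (fun x : ℝ => sinS n (x : S1)) (n * cosS n (t : S1)) t := by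
  simp only [cosS_coe, sinS_coe]
  exact ((hasDerivAt_id' t).const_mul (n : ℝ)).sin.congr_deriv (by ring)

theorem continuous_cosS (n : ℤ) : Continuous (cosS n) :=
  continuous_of_lift (contDiff_cosS n).continuous

theorem continuous_sinS (n : ℤ) : Continuous (sinS n) :=
  continuous_of_lift (contDiff_sinS n).continuous

variable {F : Type*} [NormedAddCommGroup F] [NormedSpace ℝ F]

theorem integrable_path (u : H1 F) : Integrable (path u) :=
  (Lp.memLp u.1.fst).integrable (by norm_num)

theorem integrable_vel (u : H1 F) : Integrable (vel u) :=
  (Lp.memLp u.1.snd).integrable (by norm_num)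

theorem integrable_smul_path {φ : S1 → ℝ} (h : Continuous φ) (u : H1 F) :
    Integrable (fun s => φ s • path u s) := integrable_smul h _

theorem integrable_smul_vel {φ : S1 → ℝ} (h : Continuous φ) (u : H1 F) :
    Integrable (fun s => φ s • vel u s) := integrable_smul h _

theorem integral_smul_vel (u : H1 F) {φ ψ : S1 → ℝ}
    (h : ContDiff ℝ ∞ (fun t : ℝ => φ (t : S1)))
    (hψ : ∀ t : ℝ, HasDerivAt (fun x : ℝ => φ (x : S1)) (ψ (t : S1)) t) :
    ∫ s, φ s • vel u s = - ∫ s, ψ s • path u s := by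
  have : ∫ s, ψ s • path u s = - ∫ s, φ s • vel u s := u.2 φ ψ h hψ
  rw [this, neg_neg]

/-- The mode equations live in the real space `F` and concern the vectors `∫ cos · u` and `∫ sin ·
u`; completeness of the Fourier system is a statement about complex scalars. This formula translates
between them. As `L` is only real linear, sine and cosine have to be kept apart. -/
theorem fourierCoeff_clm_comp [CompleteSpace F] {u : S1 → F} (hu : Integrable u) (L : F →L[ℝ] ℂ)
    (n : ℤ) :
    fourierCoeff (fun s => L (u s)) n = (2 * π)⁻¹ •
      (L (∫ s, cosS n s • u s) - Complex.I * L (∫ s, sinS n s • u s)) := by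
  have hi : ∀ {φ : S1 → ℝ}, Continuous φ → Integrable (fun s => φ s • u s) := by
    intro φ h
    obtain ⟨C, hC⟩ := isCompact_univ.exists_bound_of_continuousOn h.continuousOn
    exact hu.bdd_smul C h.aestronglyMeasurable (ae_of_all _ fun s => hC s (mem_univ s))
  have hc := hi (continuous_cosS n)
  have hs := hi (continuous_sinS n)
  rw [fourierCoeff, AddCircle.integral_haarAddCircle, ← L.integral_comp_comm hc,
    ← L.integral_comp_comm hs, ← integral_const_mul, ← integral_sub (L.integrable_comp hc)
    ((L.integrable_comp hs).const_mul _)]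
  congr 1
  refine integral_congr_ae (ae_of_all _ fun s => ?_)
  have : fourier (-n) s = (cosS n s : ℂ) - Complex.I * sinS n s := by
    rw [fourier_neg]
    apply Complex.ext <;> simp [cosS, sinS]
  simp only [this, map_smul, Complex.real_smul, smul_eq_mul]
  ring

theorem integral_cosS_smul_vel (u : H1 F) (n : ℤ) :
    ∫ s, cosS n s • vel u s = (n : ℝ) • ∫ s, sinS n s • path u s := by
  rw [integral_smul_vel u (contDiff_cosS n) (ψ := fun s => -n * sinS n s) (hasDerivAt_cosS n),
    ← integral_smul, ← integral_neg]
  simp only [mul_smul, neg_smul, neg_neg]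

theorem integral_sinS_smul_vel (u : H1 F) (n : ℤ) :
    ∫ s, sinS n s • vel u s = -(n : ℝ) • ∫ s, cosS n s • path u s := by
  rw [integral_smul_vel u (contDiff_sinS n) (ψ := fun s => n * cosS n s) (hasDerivAt_sinS n),
    ← integral_smul, ← integral_neg]
  simp only [mul_smul, neg_smul]

theorem fourierCoeff_vel [CompleteSpace F] (u : H1 F) (L : F →L[ℝ] ℂ) (n : ℤ) :
    fourierCoeff (fun s => L (vel u s)) n =
      Complex.I * n * fourierCoeff (fun s => L (path u s)) n := by
  rw [fourierCoeff_clm_comp (integrable_vel u), fourierCoeff_clm_comp (integrable_path u),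
    integral_cosS_smul_vel, integral_sinS_smul_vel]
  simp only [map_smul, Complex.real_smul]
  push_cast
  linear_combination ((2 * (π : ℂ))⁻¹ * n * L (∫ s, sinS n s • path u s)) * Complex.I_sq

/-- Supplies the test paths `cos (n s) w` and `sin (n s) w`. The weak derivative identity reduces to
the vanishing integral of the derivative of a product of two periodic functions. -/
theorem exists_smul_const [CompleteSpace F] (w : F) {φ ψ : S1 → ℝ}
    (h : ContDiff ℝ ∞ (fun t : ℝ => φ (t : S1)))
    (hψ : ∀ t : ℝ, HasDerivAt (fun x : ℝ => φ (x : S1)) (ψ (t : S1)) t) :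
    ∃ v : H1 F, path v =ᵐ[volume] (fun s => φ s • w) ∧ vel v =ᵐ[volume] (fun s => ψ s • w) := by
  have hφc : Continuous φ := continuous_of_lift h.continuous
  have hψc := continuous_deriv h hψ
  have hm : ∀ {χ : S1 → ℝ}, Continuous χ → MemLp (fun s => χ s • w) 2 (volume : Measure S1) :=
    fun hχ => (hχ.smul continuous_const).memLp_of_hasCompactSupport
      (HasCompactSupport.of_compactSpace _)
  have e1 := (hm hφc).coeFn_toLp
  have e2 := (hm hψc).coeFn_toLp
  refine ⟨⟨WithLp.toLp 2 ((hm hφc).toLp _, (hm hψc).toLp _), ?_⟩, e1, e2⟩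
  intro φ' ψ' h' hψ'
  have hφc' : Continuous φ' := continuous_of_lift h'.continuous
  have hψc' := continuous_deriv h' hψ'
  have hint : ∀ {χ : S1 → ℝ}, Continuous χ → Integrable χ :=
    fun hχ => hχ.integrable_of_hasCompactSupport (HasCompactSupport.of_compactSpace _)
  have key : ∫ s, (ψ' s * φ s + φ' s * ψ s) = 0 :=
    integral_deriv_eq_zero (φ := fun s => φ' s * φ s) (h'.mul h) fun t => (hψ' t).mul (hψ t)
  rw [integral_add (f := fun s => ψ' s * φ s) (g := fun s => φ' s * ψ s) (hint (hψc'.mul hφc))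
    (hint (hφc'.mul hψc))] at key
  have l1 : ∫ s, ψ' s • (hm hφc).toLp _ s = (∫ s, ψ' s * φ s) • w := by
    rw [← integral_smul_const]
    refine integral_congr_ae ?_
    filter_upwards [e1] with s hs
    rw [hs, smul_smul]
  have l2 : ∫ s, φ' s • (hm hψc).toLp _ s = (∫ s, φ' s * ψ s) • w := by
    rw [← integral_smul_const]
    refine integral_congr_ae ?_
    filter_upwards [e2] with s hs
    rw [hs, smul_smul]
  change ∫ s, ψ' s • (hm hφc).toLp _ s = - ∫ s, φ' s • (hm hψc).toLp _ s
  rw [l1, l2, eq_neg_of_add_eq_zero_left key, neg_smul]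

theorem H1.ext {u v : H1 F} (h1 : path u =ᵐ[volume] path v) (h2 : vel u =ᵐ[volume] vel v) :
    u = v := by
  apply Subtype.ext
  apply (WithLp.equiv 2 _).injective
  exact Prod.ext (Lp.ext h1) (Lp.ext h2)

theorem ae_eq_of_fourierCoeff_eq {f g : S1 → ℂ} (hf : MemLp f 2) (hg : MemLp g 2)
    (h : ∀ n, fourierCoeff f n = fourierCoeff g n) : f =ᵐ[volume] g := by
  have hf' := hf.haarAddCircle
  have hg' := hg.haarAddCircle
  have e : hf'.toLp f = hg'.toLp g := by
    apply fourierBasis.repr.injective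
    ext n
    rw [fourierBasis_repr, fourierBasis_repr, fourierCoeff_congr_ae hf'.coeFn_toLp,
      fourierCoeff_congr_ae hg'.coeFn_toLp, h]
  have e' : f =ᵐ[AddCircle.haarAddCircle] g :=
    hf'.coeFn_toLp.symm.trans ((by rw [e]) : _ =ᵐ[_] _) |>.trans hg'.coeFn_toLp
  rw [AddCircle.volume_eq_smul_haarAddCircle]
  exact Measure.ae_smul_measure e' _

theorem ae_eq_zero_of_fourierCoeff {f : S1 → ℂ} (hf : MemLp f 2)
    (h : ∀ n, fourierCoeff f n = 0) : f =ᵐ[volume] fun _ => 0 :=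
  ae_eq_of_fourierCoeff_eq hf MemLp.zero fun n => by
    rw [h]; simp [fourierCoeff]

theorem summable_inv_one_add_sq : Summable fun n : ℤ => (1 + (n : ℝ) ^ 2)⁻¹ := by
  have h : Summable fun n : ℤ => 1 / (n : ℝ) ^ 2 := Real.summable_one_div_int_pow.2 (by norm_num)
  refine h.of_norm_bounded_eventually ?_
  have : ∀ᶠ n : ℤ in cofinite, n ≠ 0 := by
    rw [Filter.eventually_cofinite]
    simp
  filter_upwards [this] with n hn
  have : (0 : ℝ) < (n : ℝ) ^ 2 := by positivity
  rw [Real.norm_of_nonneg (by positivity), one_div]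
  gcongr
  linarith

/-- The Sobolev embedding on the circle, for complex valued functions. -/
theorem exists_continuous_representative : ∃ C : ℝ, 0 ≤ C ∧
    ∀ f g : Lp ℂ 2 (volume : Measure S1),
      (∀ n : ℤ, fourierCoeff g n = Complex.I * n * fourierCoeff f n) →
      ∃ h : C(S1, ℂ), h =ᵐ[volume] f ∧ ‖h‖ ≤ C * (‖f‖ + ‖g‖) := by
  refine ⟨√(∑' n : ℤ, (1 + (n : ℝ) ^ 2)⁻¹), Real.sqrt_nonneg _, fun f g hfg => ?_⟩
  have parseval : ∀ f : Lp ℂ 2 (volume : Measure S1),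
      HasSum (fun n => ‖fourierCoeff f n‖ ^ 2) ((2 * π)⁻¹ * ‖f‖ ^ 2) := by
    intro f
    have hf := (Lp.memLp f).haarAddCircle
    have := hasSum_sq_fourierCoeff (hf.toLp f)
    rw [fourierCoeff_congr_ae hf.coeFn_toLp] at this
    convert this using 1
    have e : ∫ t, ‖hf.toLp f t‖ ^ 2 ∂AddCircle.haarAddCircle =
        ∫ t, ‖f t‖ ^ 2 ∂AddCircle.haarAddCircle := by
      refine integral_congr_ae ?_
      filter_upwards [hf.coeFn_toLp] with s hs
      rw [hs]
    rw [e, AddCircle.integral_haarAddCircle, smul_eq_mul, ← real_inner_self_eq_norm_sq,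
        L2.inner_def]
    simp
  -- Cauchy–Schwarz for `|f̂(n)| = (1 + n²)^(-1/2) · ((1 + n²)^(1/2) |f̂(n)|)`: the first factor is
  -- square summable, and the square of the second is `|f̂(n)|² + |ĝ(n)|²`. So the Fourier series of
  -- `f` converges absolutely.
  set a : ℤ → ℝ := fun n => √((1 + (n : ℝ) ^ 2)⁻¹)
  set b : ℤ → ℝ := fun n => √(‖fourierCoeff f n‖ ^ 2 + ‖fourierCoeff g n‖ ^ 2)
  have ha : ∀ n, a n ^ (2 : ℝ) = (1 + (n : ℝ) ^ 2)⁻¹ := fun n => by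
    rw [Real.rpow_two]; exact Real.sq_sqrt (by positivity)
  have hb : ∀ n, b n ^ (2 : ℝ) = ‖fourierCoeff f n‖ ^ 2 + ‖fourierCoeff g n‖ ^ 2 := fun n => by
    rw [Real.rpow_two]; exact Real.sq_sqrt (by positivity)
  have hsum := (parseval f).add (parseval g)
  have cs := Real.summable_and_inner_le_Lp_mul_Lq_tsum_of_nonneg Real.HolderConjugate.two_two
    (f := a) (g := b) (fun n => Real.sqrt_nonneg _) (fun n => Real.sqrt_nonneg _)
    (by simpa only [ha] using summable_inv_one_add_sq) (by simpa only [hb] using hsum.summable)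
  have hab : ∀ n, ‖fourierCoeff f n‖ = a n * b n := by
    intro n
    have h1 : ‖fourierCoeff f n‖ ^ 2 + ‖fourierCoeff g n‖ ^ 2 =
        (1 + (n : ℝ) ^ 2) * ‖fourierCoeff f n‖ ^ 2 := by
      rw [hfg n]
      simp only [norm_mul, Complex.norm_I, one_mul, Complex.norm_intCast, mul_pow, sq_abs]
      ring
    simp only [a, b]
    rw [h1, ← Real.sqrt_mul (by positivity), inv_mul_cancel_left₀ (by positivity),
      Real.sqrt_sq (norm_nonneg _)]
  simp only [← hab, ha, hb, hsum.tsum_eq, ← Real.sqrt_eq_rpow] at cs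
  obtain ⟨hs, hle⟩ := cs
  have hs' : Summable fun n => ‖fourierCoeff f n • (fourier n : C(S1, ℂ))‖ := by
    simpa only [norm_smul, fourier_norm, mul_one] using hs
  obtain ⟨h, hh⟩ := hs'.of_norm
  refine ⟨h, ?_, ?_⟩
  · have hf := (Lp.memLp f).haarAddCircle
    have h1 := hasSum_fourier_series_L2 (hf.toLp f)
    rw [fourierCoeff_congr_ae hf.coeFn_toLp] at h1
    have h2 := (ContinuousMap.toLp (E := ℂ) 2 AddCircle.haarAddCircle ℂ).hasSum hh
    simp only [map_smul] at h2
    have e := h2.unique h1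
    have e' : h =ᵐ[AddCircle.haarAddCircle] f :=
      (ContinuousMap.coeFn_toLp _ h).symm.trans (((by rw [e]) : _ =ᵐ[_] _).trans hf.coeFn_toLp)
    exact Measure.ae_smul_measure e' (ENNReal.ofReal (2 * π))
  · rw [← hh.tsum_eq]
    refine (norm_tsum_le_tsum_norm hs').trans ?_
    simp only [norm_smul, fourier_norm, mul_one]
    refine hle.trans ?_
    gcongr
    refine Real.sqrt_le_iff.2 ⟨by positivity, ?_⟩
    have hpi : (2 * π)⁻¹ ≤ 1 := inv_le_one_of_one_le₀ (by linarith [Real.pi_gt_three])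
    nlinarith [norm_nonneg f, norm_nonneg g, sq_nonneg ‖f‖, sq_nonneg ‖g‖,
      mul_nonneg (norm_nonneg f) (norm_nonneg g)]

end Sobolev

/-- Multiplication by a bump function. It replaces the potential, singular at collisions, by a
globally regular function to which the superposition results apply. -/
theorem ContDiffAt.exists_contDiff_eventuallyEq {E : Type*} [NormedAddCommGroup E]
    [NormedSpace ℝ E] [HasContDiffBump E] {n : ℕ} {f : E → ℝ} {x : E} (hf : ContDiffAt ℝ n f x) :
    ∃ g : E → ℝ, ContDiff ℝ n g ∧ g =ᶠ[𝓝 x] f := by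
  obtain ⟨r, hr, h⟩ := Metric.nhds_basis_closedBall.eventually_iff.1 (hf.eventually (by simp))
  let χ : ContDiffBump x := ⟨r / 2, r, by linarith, by linarith⟩
  refine ⟨fun y => χ y * f y, contDiff_iff_contDiffAt.2 fun y => ?_, ?_⟩
  · by_cases hy : y ∈ Metric.closedBall x r
    · exact χ.contDiff.contDiffAt.mul (h hy)
    · have : (fun y => χ y * f y) =ᶠ[𝓝 y] fun _ => 0 := by
        filter_upwards [Metric.isClosed_closedBall.isOpen_compl.mem_nhds hy] with z hz
        rw [χ.zero_of_le_dist, zero_mul]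
        exact (not_le.1 fun h => hz (Metric.mem_closedBall.2 h)).le
      exact contDiffAt_const.congr_of_eventuallyEq this
  · filter_upwards [χ.eventuallyEq_one] with y hy
    simp [hy]

/-! ### Derivatives of the pair potential and of the potential -/

namespace NBody

open scoped RealInnerProductSpace

theorem hasFDerivAt_norm_complex {x : ℂ} (hx : x ≠ 0) :
    HasFDerivAt (fun y : ℂ => ‖y‖) (‖x‖⁻¹ • innerSL ℝ x) x := by
  have h := (hasStrictFDerivAt_norm_sq x).hasFDerivAt.sqrt (by positivity)
  have e : (fun y : ℂ => √(‖y‖ ^ 2)) = fun y => ‖y‖ := funext fun y => Real.sqrt_sq (norm_nonneg y)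
  rw [e, Real.sqrt_sq (norm_nonneg x)] at h
  refine h.congr_fderiv ?_
  ext z
  simp
  ring

theorem hasFDerivAt_norm_rpow {x : ℂ} (hx : x ≠ 0) (s : ℝ) :
    HasFDerivAt (fun y : ℂ => ‖y‖ ^ s) ((s * ‖x‖ ^ (s - 2)) • innerSL ℝ x) x := by
  have hx' : 0 < ‖x‖ := norm_pos_iff.2 hx
  refine ((Real.hasDerivAt_rpow_const (p := s) (Or.inl hx'.ne')).comp_hasFDerivAt x
    (hasFDerivAt_norm_complex hx)).congr_fderiv ?_
  rw [smul_smul, mul_assoc, show s - 2 = s - 1 - 1 by ring, Real.rpow_sub_one hx'.ne' (s - 1)]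
  rfl

/-- The logarithmic case and the power case have the same derivative, so `α = 1` needs no separate
treatment from here on. -/
theorem hasFDerivAt_pairPotential (α : ℝ) {x : ℂ} (hx : x ≠ 0) :
    HasFDerivAt (fun y : ℂ => pairPotential α ‖y‖) ((-‖x‖ ^ (-(α + 1))) • innerSL ℝ x) x := by
  have hx' : 0 < ‖x‖ := norm_pos_iff.2 hx
  unfold pairPotential
  split_ifs with h
  · refine ((hasFDerivAt_norm_complex hx).log hx'.ne').neg.congr_fderiv ?_
    rw [h, show -((1 : ℝ) + 1) = -1 - 1 by norm_num, Real.rpow_sub_one hx'.ne', Real.rpow_neg_one,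
      smul_smul, neg_smul, div_eq_mul_inv]
  · have h' : α - 1 ≠ 0 := sub_ne_zero.2 h
    refine ((hasFDerivAt_norm_rpow hx (1 - α)).mul_const (α - 1)⁻¹).congr_fderiv ?_
    rw [smul_smul, show 1 - α - 2 = -(α + 1) by ring]
    congr 1
    field_simp
    ring

theorem contDiffAt_pairPotential (α : ℝ) {x : ℂ} (hx : x ≠ 0) (n : WithTop ℕ∞) :
    ContDiffAt ℝ n (fun y : ℂ => pairPotential α ‖y‖) x := by
  have hx' : 0 < ‖x‖ := norm_pos_iff.2 hx
  unfold pairPotential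
  split_ifs with h
  · exact ((contDiffAt_norm ℝ hx).log hx'.ne').neg
  · exact ((contDiffAt_norm ℝ hx).rpow_const_of_ne hx'.ne').div_const _

/-- The real inner product of `ℂ`, as a continuous bilinear form. -/
def innerCLM : ℂ →L[ℝ] ℂ →L[ℝ] ℝ := innerSL ℝ

@[simp]
theorem innerCLM_apply (x y : ℂ) : innerCLM x y = ⟪x, y⟫ := rfl

theorem hasHessianAt_pairPotential (α : ℝ) {x : ℂ} (hx : x ≠ 0) :
    HasHessianAt (fun y : ℂ => pairPotential α ‖y‖) ((-‖x‖ ^ (-(α + 1))) • innerCLM x)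
      ((-‖x‖ ^ (-(α + 1))) • innerCLM +
        (((α + 1) * ‖x‖ ^ (-(α + 3))) • innerCLM x).smulRight (innerCLM x)) x := by
  refine HasHessianAt.of_hasFDerivAt (F' := fun y => (-‖y‖ ^ (-(α + 1))) • innerCLM y)
    (contDiffAt_pairPotential α hx 2) ?_ ?_
  · filter_upwards [isOpen_ne.mem_nhds hx] with y hy
    exact hasFDerivAt_pairPotential α hy
  · have h1 : HasFDerivAt (fun y : ℂ => -‖y‖ ^ (-(α + 1)))
        (((α + 1) * ‖x‖ ^ (-(α + 3))) • innerCLM x) x := by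
      refine (hasFDerivAt_norm_rpow hx (-(α + 1))).neg.congr_fderiv ?_
      rw [show -(α + 1) - 2 = -(α + 3) by ring, ← neg_smul]
      congr 1
      ring
    exact h1.smul innerCLM.hasFDerivAt

variable {n : ℕ}

/-- The relative position of the bodies `k` and `k'`. -/
def diffCLM (k k' : Fin n) : PiLp 2 (fun _ : Fin n => ℂ) →L[ℝ] ℂ :=
  PiLp.proj (𝕜 := ℝ) 2 (fun _ : Fin n => ℂ) k - PiLp.proj (𝕜 := ℝ) 2 (fun _ : Fin n => ℂ) k'

@[simp]
theorem diffCLM_apply (k k' : Fin n) (x : PiLp 2 (fun _ : Fin n => ℂ)) :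
    diffCLM k k' x = x k - x k' := rfl

theorem hasHessianAt_potential (m : Fin n → ℝ) (α : ℝ) {x : PiLp 2 (fun _ : Fin n => ℂ)}
    (hx : Function.Injective fun k => x k) :
    ∃ U' B, HasHessianAt (potential m α) U' B x ∧
      (∀ y, U' y = ∑ k, ∑ k' ∈ Finset.Ioi k, m k * m k' *
        (-‖x k - x k'‖ ^ (-(α + 1)) * ⟪x k - x k', y k - y k'⟫)) ∧
      ∀ y z, B y z = ∑ k, ∑ k' ∈ Finset.Ioi k, m k * m k' *
        (-‖x k - x k'‖ ^ (-(α + 1)) * ⟪y k - y k', z k - z k'⟫ +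
          (α + 1) * ‖x k - x k'‖ ^ (-(α + 3)) * ⟪x k - x k', y k - y k'⟫ *
            ⟪x k - x k', z k - z k'⟫) := by
  refine ⟨_, _, HasHessianAt.sum Finset.univ fun k _ =>
    HasHessianAt.sum (Finset.Ioi k) fun k' hk' =>
    HasHessianAt.const_mul (m k * m k')
      (HasHessianAt.comp_clm (diffCLM k k') (hasHessianAt_pairPotential α (?_))), ?_, ?_⟩
  · rw [diffCLM_apply, sub_ne_zero]
    exact hx.ne (Finset.mem_Ioi.1 hk').ne
  · intro y
    simp only [sum_apply, smul_apply,
      ContinuousLinearMap.comp_apply, innerCLM_apply, diffCLM_apply, smul_eq_mul]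
  · intro y z
    simp only [sum_apply, smul_apply,
      ContinuousLinearMap.comp_apply, add_apply, innerCLM_apply,
      diffCLM_apply, smul_eq_mul, ContinuousLinearMap.precomp_apply,
      ContinuousLinearMap.smulRight_apply]

end NBody

/-! ### Sobolev embedding for vector-valued paths -/

namespace Sobolev

variable {F : Type*} [NormedAddCommGroup F] [NormedSpace ℝ F]

variable (F) in
/-- The inclusion `H¹ → L²`. -/
def pathL : H1 F →L[ℝ] Lp F 2 (volume : Measure S1) :=
  (WithLp.fstL 2 ℝ (Lp F 2 (volume : Measure S1)) (Lp F 2 (volume : Measure S1))).comp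
    (H1submodule F).subtypeL

variable (F) in
/-- The weak derivative as an operator `H¹ → L²`. -/
def velL : H1 F →L[ℝ] Lp F 2 (volume : Measure S1) :=
  (WithLp.sndL 2 ℝ (Lp F 2 (volume : Measure S1)) (Lp F 2 (volume : Measure S1))).comp
    (H1submodule F).subtypeL

theorem fourierCoeff_congr {f g : S1 → ℂ} (h : f =ᵐ[volume] g) :
    fourierCoeff f = fourierCoeff g := by
  funext n
  rw [fourierCoeff, fourierCoeff, AddCircle.integral_haarAddCircle,
    AddCircle.integral_haarAddCircle]
  congr 1
  refine integral_congr_ae ?_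
  filter_upwards [h] with s hs
  rw [hs]

theorem continuousMap_eq_of_ae_eq {E : Type*} [TopologicalSpace E] [T2Space E] {f g : C(S1, E)}
    (h : f =ᵐ[volume] g) : f = g :=
  ContinuousMap.ext fun s =>
    congrFun (Continuous.ae_eq_iff_eq volume f.continuous g.continuous |>.1 h) s

theorem exists_continuous_representative_clm [CompleteSpace F] (L : F →L[ℝ] ℂ) :
    ∃ T : H1 F →L[ℝ] C(S1, ℂ), ∀ u, T u =ᵐ[volume] fun s => L (path u s) := by
  obtain ⟨C, hC, h⟩ := exists_continuous_representative
  have h1 : ∀ u : H1 F, ∃ t : C(S1, ℂ), (t =ᵐ[volume] fun s => L (path u s)) ∧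
      ‖t‖ ≤ C * (‖L‖ * ‖pathL F‖ + ‖L‖ * ‖velL F‖) * ‖u‖ := by
    intro u
    have e1 : L.compLp (pathL F u) =ᵐ[volume] fun s => L (path u s) := L.coeFn_compLp (pathL F u)
    have e2 : L.compLp (velL F u) =ᵐ[volume] fun s => L (vel u s) := L.coeFn_compLp (velL F u)
    obtain ⟨t, ht, hn⟩ := h (L.compLp (pathL F u)) (L.compLp (velL F u)) fun n => by
      rw [fourierCoeff_congr e1, fourierCoeff_congr e2, fourierCoeff_vel]
    refine ⟨t, ht.trans e1, hn.trans ?_⟩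
    rw [mul_assoc, add_mul]
    gcongr
    · refine (L.norm_compLp_le _).trans ?_
      rw [mul_assoc]
      gcongr
      exact (pathL F).le_opNorm u
    · refine (L.norm_compLp_le _).trans ?_
      rw [mul_assoc]
      gcongr
      exact (velL F).le_opNorm u
  choose t ht hn using h1
  refine ⟨LinearMap.mkContinuous
    { toFun := t
      map_add' := fun u v => continuousMap_eq_of_ae_eq ?_
      map_smul' := fun c u => continuousMap_eq_of_ae_eq ?_ } _ hn, ht⟩
  · have e : path (u + v) =ᵐ[volume] path u + path v := Lp.coeFn_add _ _
    filter_upwards [ht u, ht v, ht (u + v), e] with s h1 h2 h3 h4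
    rw [h3, h4, ContinuousMap.add_apply, h1, h2, Pi.add_apply, map_add]
  · have e : path (c • u) =ᵐ[volume] c • path u := Lp.coeFn_smul _ _
    filter_upwards [ht u, ht (c • u), e] with s h1 h2 h3
    rw [h2, h3, RingHom.id_apply, ContinuousMap.smul_apply, h1, Pi.smul_apply, map_smul]

theorem path_constPath [CompleteSpace F] (a : F) : path (constPath a) =ᵐ[volume] fun _ => a :=
  Lp.coeFn_const (p := 2) (μ := (volume : Measure S1)) a

theorem vel_constPath [CompleteSpace F] (a : F) : vel (constPath a) =ᵐ[volume] fun _ => 0 :=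
  Lp.coeFn_zero F 2 (volume : Measure S1)

end Sobolev

/-! ### The Hessian of the action at a constant path -/

namespace NBody

open Sobolev
open scoped RealInnerProductSpace

variable {n : ℕ} {m : Fin n → ℝ}

variable (m) in
/-- The inclusion of the reduced configuration space. -/
def configL : Reduced m →L[ℝ] PiLp 2 (fun _ : Fin n => ℂ) := (reducedSubmodule m).subtypeL

variable (m) in
/-- The position of the body `k`. -/
def positionL (k : Fin n) : Reduced m →L[ℝ] ℂ :=
  (PiLp.proj (𝕜 := ℝ) 2 (fun _ : Fin n => ℂ) k).comp (configL m)

@[simp]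
theorem positionL_apply (k : Fin n) (a : Reduced m) : positionL m k a = a.config k := rfl

variable (m) in
-- Boundedness of `T` is the point: paths close in `H¹` are uniformly close, so paths near a
-- collision-free constant stay away from collisions.
theorem exists_continuous_path : ∃ T : H1 (Reduced m) →L[ℝ] C(S1, PiLp 2 (fun _ : Fin n => ℂ)),
    ∀ u, ∀ᵐ s, T u s = (path u s).config := by
  choose T hT using fun k => exists_continuous_representative_clm (positionL m k)
  let e : (∀ _ : Fin n, ℂ) →L[ℝ] PiLp 2 (fun _ : Fin n => ℂ) :=
    (PiLp.continuousLinearEquiv 2 ℝ (fun _ : Fin n => ℂ)).symm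
  refine ⟨∑ k, ((e.comp (ContinuousLinearMap.single ℝ (fun _ : Fin n => ℂ) k)).compLeftContinuous
    ℝ S1).comp (T k), fun u => ?_⟩
  filter_upwards [ae_all_iff.2 fun k => hT k u] with s hs
  ext k
  simp [e, Finset.sum_apply, Pi.single_apply, hs]

variable (m) in
/-- The velocity of the body `k` in the inertial frame. -/
def inertialVelocity (p : ℤ) (k : Fin n) : H1 (Reduced m) →L[ℝ] Lp ℂ 2 (volume : Measure S1) :=
  (1 / p : ℝ) • ((positionL m k).compLpL 2 volume).comp (velL (Reduced m)) +
    ((Complex.I • positionL m k).compLpL 2 volume).comp (pathL (Reduced m))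

theorem coeFn_inertialVelocity (p : ℤ) (k : Fin n) (u : H1 (Reduced m)) :
    inertialVelocity m p k u =ᵐ[volume] fun s =>
      ((1 / p : ℝ) : ℂ) * (vel u s).config k + Complex.I * (path u s).config k := by
  have e0 := Lp.coeFn_add ((1 / p : ℝ) • (positionL m k).compLp (velL (Reduced m) u))
    ((Complex.I • positionL m k).compLp (pathL (Reduced m) u))
  have e1 := Lp.coeFn_smul (1 / p : ℝ) ((positionL m k).compLp (velL (Reduced m) u))
  have e2 := (positionL m k).coeFn_compLp (velL (Reduced m) u)
  have e3 := (Complex.I • positionL m k).coeFn_compLp (pathL (Reduced m) u)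
  filter_upwards [e0, e1, e2, e3] with s h0 h1 h2 h3
  refine h0.trans ?_
  rw [Pi.add_apply, h1, Pi.smul_apply, h2, h3, Complex.real_smul]
  rfl

theorem hasHessianAt_action (α : ℝ) (p : ℤ) (b : Reduced m)
    {U' : PiLp 2 (fun _ : Fin n => ℂ) →L[ℝ] ℝ}
    {B : PiLp 2 (fun _ : Fin n => ℂ) →L[ℝ] PiLp 2 (fun _ : Fin n => ℂ) →L[ℝ] ℝ}
    (hU : HasHessianAt (potential m α) U' B b.config) :
    ∃ A' H, HasHessianAt (action m α p) A' H (constPath b) ∧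
      (∀ v, A' v = ∑ k, m k * ⟪inertialVelocity m p k (constPath b), inertialVelocity m p k v⟫ +
        ∫ s, U' (path v s).config) ∧
      ∀ u v, H u v = ∑ k, m k * ⟪inertialVelocity m p k u, inertialVelocity m p k v⟫ +
        ∫ s, B (path u s).config (path v s).config := by
  obtain ⟨T, hT⟩ := exists_continuous_path m
  obtain ⟨g, hg, hgU⟩ := ContDiffAt.exists_contDiff_eventuallyEq (n := 2) hU.contDiffAt
  have hTb : ∀ s, T (constPath b) s = b.config := by
    have : T (constPath b) = ContinuousMap.const S1 b.config := by
      apply continuousMap_eq_of_ae_eq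
      filter_upwards [hT (constPath b), path_constPath b] with s h1 h2
      rw [h1, h2, ContinuousMap.const_apply]
    intro s
    rw [this, ContinuousMap.const_apply]
  obtain ⟨N', D, hN, hN', hD⟩ :=
    hasHessianAt_integral_comp (volume : Measure S1) hg (T (constPath b))
  have hkin := HasHessianAt.sum Finset.univ (x := constPath b) fun k _ =>
    ((HasHessianAt.half_norm_sq (inertialVelocity m p k (constPath b))).comp_clm
      (inertialVelocity m p k)).const_mul (m k)
  refine ⟨_, _, (hkin.add (hN.comp_clm T)).congr ?_, ?_, ?_⟩
  · obtain ⟨ε, hε, hball⟩ := Metric.eventually_nhds_iff.1 hgU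
    -- For such `w` the whole path stays in the ball where `g` agrees with the potential, so the
    -- cut-off does not change the action near `constPath b`.
    have hc : ∀ᶠ w in 𝓝 (constPath b), dist (T w) (T (constPath b)) < ε :=
      T.continuous.continuousAt.eventually (Metric.ball_mem_nhds _ hε)
    filter_upwards [hc] with w hw
    have h1 : ∀ s, potential m α (T w s) = g (T w s) := fun s => by
      refine (hball ?_).symm
      rw [← hTb s]
      exact (ContinuousMap.dist_apply_le_dist s).trans_lt hw
    have e1 : ∀ k, ‖inertialVelocity m p k w‖ ^ 2 = ∫ s, ‖inertialVelocity m p k w s‖ ^ 2 := by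
      intro k
      rw [← real_inner_self_eq_norm_sq, L2.inner_def]
      simp only [real_inner_self_eq_norm_sq]
    have i1 : ∀ k, Integrable fun s => m k * (1 / 2 * ‖inertialVelocity m p k w s‖ ^ 2) := by
      intro k
      refine ((Integrable.const_mul ?_ (1 / 2)).const_mul (m k))
      simpa only [real_inner_self_eq_norm_sq] using
        L2.integrable_inner (𝕜 := ℝ) (inertialVelocity m p k w) (inertialVelocity m p k w)
    have i2 : Integrable fun s => g (T w s) :=
      ContinuousMap.integrable_of_isFiniteMeasure volume
        ((ContinuousMap.mk g hg.continuous).comp (T w))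
    simp only [e1, ← integral_const_mul]
    rw [← integral_finsetSum _ fun k _ => i1 k,
      ← integral_add (integrable_finsetSum _ fun k _ => i1 k) i2]
    refine integral_congr_ae ?_
    filter_upwards [hT w, ae_all_iff.2 fun k => coeFn_inertialVelocity p k w] with s h2 h3
    simp only [h3, lagrangian, Finset.mul_sum]
    congr 1
    · refine Finset.sum_congr rfl fun k _ => ?_
      ring
    · rw [← h2, h1]
  · intro v
    simp only [add_apply, sum_apply, smul_apply, ContinuousLinearMap.comp_apply, hN', smul_eq_mul,
      innerSL_apply_apply]
    congr 1
    refine integral_congr_ae ?_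
    filter_upwards [hT v] with s h1
    rw [h1, hTb, hgU.fderiv_eq, hU.fderiv_eq]
  · intro u v
    simp only [add_apply, sum_apply, smul_apply, ContinuousLinearMap.comp_apply, hD, smul_eq_mul,
      ContinuousLinearMap.precomp_apply]
    congr 1
    refine integral_congr_ae ?_
    filter_upwards [hT u, hT v] with s h1 h2
    rw [h1, h2, hTb, hgU.fderiv.fderiv_eq, hU.fderiv_fderiv_eq]

end NBody

/-! ### The Hessian tested against a single Fourier mode -/

namespace NBody

open Sobolev
open scoped RealInnerProductSpace

variable {n : ℕ} {m : Fin n → ℝ}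

theorem integral_smul_inertialVelocity (p : ℤ) (k : Fin n) (u : H1 (Reduced m)) {φ : S1 → ℝ}
    (h : Continuous φ) :
    ∫ s, φ s • inertialVelocity m p k u s =
      ((1 / p : ℝ) : ℂ) * positionL m k (∫ s, φ s • vel u s) +
        Complex.I * positionL m k (∫ s, φ s • path u s) := by
  have i1 := integrable_smul_vel h u
  have i2 := integrable_smul_path h u
  rw [← (positionL m k).integral_comp_comm i1, ← (positionL m k).integral_comp_comm i2,
    ← integral_const_mul, ← integral_const_mul, ← integral_add
    (((positionL m k).integrable_comp i1).const_mul _)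
    (((positionL m k).integrable_comp i2).const_mul _)]
  refine integral_congr_ae ?_
  filter_upwards [coeFn_inertialVelocity p k u] with s hs
  simp only [hs, map_smul, Complex.real_smul, positionL_apply]
  ring

/-- Integration by parts moves every derivative from `u` to the scalar factor of `v`. As `J` is
skew, the two cross terms are equal and add up to the Coriolis term with factor 2. -/
theorem inner_inertialVelocity (p : ℤ) (k : Fin n) (u v : H1 (Reduced m)) (w : Reduced m)
    {φ ψ χ : S1 → ℝ} (h : ContDiff ℝ ∞ (fun t : ℝ => φ (t : S1)))
    (h' : ContDiff ℝ ∞ (fun t : ℝ => ψ (t : S1)))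
    (hψ : ∀ t : ℝ, HasDerivAt (fun x : ℝ => φ (x : S1)) (ψ (t : S1)) t)
    (hχ : ∀ t : ℝ, HasDerivAt (fun x : ℝ => ψ (x : S1)) (χ (t : S1)) t)
    (hv : path v =ᵐ[volume] fun s => φ s • w) (hv' : vel v =ᵐ[volume] fun s => ψ s • w) :
    ⟪inertialVelocity m p k u, inertialVelocity m p k v⟫ =
      ⟪-((1 / p : ℝ) : ℂ) ^ 2 * positionL m k (∫ s, χ s • path u s) +
        2 * ((1 / p : ℝ) : ℂ) * Complex.I * positionL m k (∫ s, ψ s • path u s) +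
        positionL m k (∫ s, φ s • path u s), w.config k⟫ := by
  have hφc : Continuous φ := continuous_of_lift h.continuous
  have hψc : Continuous ψ := continuous_of_lift h'.continuous
  have i : ∀ {φ : S1 → ℝ}, Continuous φ →
      Integrable fun s => φ s • inertialVelocity m p k u s := fun h => integrable_smul h _
  have e : ⟪inertialVelocity m p k u, inertialVelocity m p k v⟫ =
      ⟪∫ s, ψ s • inertialVelocity m p k u s, ((1 / p : ℝ) : ℂ) * w.config k⟫ +
        ⟪∫ s, φ s • inertialVelocity m p k u s, Complex.I * w.config k⟫ := by
    have e3 : ∀ {φ : S1 → ℝ} (z : ℂ), Continuous φ →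
        ⟪∫ s, φ s • inertialVelocity m p k u s, z⟫ =
          ∫ s, ⟪z, φ s • inertialVelocity m p k u s⟫ := fun z h => by
      rw [real_inner_comm, integral_inner (i h)]
    rw [e3 _ hψc, e3 _ hφc, ← integral_add ((i hψc).const_inner _) ((i hφc).const_inner _),
      L2.inner_def]
    refine integral_congr_ae ?_
    filter_upwards [coeFn_inertialVelocity p k v, hv, hv'] with s h1 h2 h3
    have e1 : (φ s • w).config k = φ s • w.config k := rfl
    have e2 : (ψ s • w).config k = ψ s • w.config k := rfl
    rw [h1, h2, h3, e1, e2, real_inner_smul_right, real_inner_smul_right,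
      real_inner_comm _ (((1 / p : ℝ) : ℂ) * w.config k),
      real_inner_comm _ (Complex.I * w.config k), ← real_inner_smul_right,
      ← real_inner_smul_right, ← inner_add_right]
    congr 1
    simp only [Complex.real_smul]
    ring
  rw [e, integral_smul_inertialVelocity p k u hφc, integral_smul_inertialVelocity p k u hψc,
    integral_smul_vel u h hψ, integral_smul_vel u h' hχ]
  simp only [Complex.inner, map_neg]
  rw [← Complex.add_re]
  congr 1
  simp only [map_add, map_mul, Complex.conj_I, Complex.conj_ofReal, map_neg, map_pow, map_ofNat]
  linear_combination (-(starRingEnd ℂ) (positionL m k (∫ s, φ s • path u s)) * w.config k) *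
    Complex.I_sq

/-- The kinetic part of the Hessian of the action against a constant path. -/
theorem inner_inertialVelocity_constPath (p : ℤ) (k : Fin n) (u : H1 (Reduced m)) (w : Reduced m) :
    ⟪inertialVelocity m p k u, inertialVelocity m p k (constPath w)⟫ =
      ⟪positionL m k (∫ s, path u s), w.config k⟫ := by
  have := inner_inertialVelocity p k u (constPath w) w (φ := fun _ => 1) (ψ := fun _ => 0)
    (χ := fun _ => 0) contDiff_const contDiff_const (fun _ => hasDerivAt_const _ _)
    (fun _ => hasDerivAt_const _ _) (by simpa using path_constPath w)
    (by simpa using vel_constPath w)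
  simpa only [zero_smul, integral_zero, one_smul, map_zero, mul_zero, zero_add] using this

theorem integral_bilinear_path
    (B : PiLp 2 (fun _ : Fin n => ℂ) →L[ℝ] PiLp 2 (fun _ : Fin n => ℂ) →L[ℝ] ℝ)
    (u v : H1 (Reduced m)) (w : Reduced m) {φ : S1 → ℝ} (h : Continuous φ)
    (hv : path v =ᵐ[volume] fun s => φ s • w) :
    ∫ s, B (path u s).config (path v s).config =
      B (∫ s, φ s • path u s : Reduced m).config w.config := by
  have := ((B.flip w.config).comp (configL m)).integral_comp_comm (integrable_smul_path h u)
  change _ = ((B.flip w.config).comp (configL m)) (∫ s, φ s • path u s)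
  rw [← this]
  refine integral_congr_ae ?_
  filter_upwards [hv] with s hs
  have e : (φ s • w).config = φ s • w.config := rfl
  rw [hs, e, map_smul, map_smul]
  rfl

end NBody

namespace NBody

open scoped ComplexConjugate

/-! ### The linearized equations in Fourier modes -/

/-- The system is only real linear. Combining one equation with the other and with its own conjugate
eliminates all unknowns but one, leaving the determinant excluded by `hne` as its factor. -/
theorem eq_zero_of_transversal_mode {ν γ : ℝ} {κ yc ys : ℂ}
    (hne : (ν ^ 2 + γ) ^ 2 - 4 * ν ^ 2 ≠ γ ^ 2 * Complex.normSq κ)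
    (h1 : ν ^ 2 * yc - 2 * ν * Complex.I * ys + γ * yc - γ * κ * conj yc = 0)
    (h2 : ν ^ 2 * ys + 2 * ν * Complex.I * yc + γ * ys - γ * κ * conj ys = 0) :
    yc = 0 ∧ ys = 0 := by
  have hne' : ((ν : ℂ) ^ 2 + γ) ^ 2 - 4 * ν ^ 2 - γ ^ 2 * (κ * conj κ) ≠ 0 := by
    rw [Complex.mul_conj, sub_ne_zero]
    exact_mod_cast hne
  have c1 := congrArg conj h1
  have c2 := congrArg conj h2
  simp only [map_add, map_sub, map_mul, map_pow, Complex.conj_ofReal, Complex.conj_I, map_ofNat,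
    Complex.conj_conj, map_zero] at c1 c2
  have hI := Complex.I_sq
  have e1 : (((ν : ℂ) ^ 2 + γ) ^ 2 - 4 * ν ^ 2 - γ ^ 2 * (κ * conj κ)) * yc = 0 := by
    linear_combination ((ν : ℂ) ^ 2 + γ) * h1 + 2 * ν * Complex.I * h2 + γ * κ * c1 +
      (-4 * (ν : ℂ) ^ 2 * yc) * hI
  have e2 : (((ν : ℂ) ^ 2 + γ) ^ 2 - 4 * ν ^ 2 - γ ^ 2 * (κ * conj κ)) * ys = 0 := by
    linear_combination ((ν : ℂ) ^ 2 + γ) * h2 - 2 * ν * Complex.I * h1 + γ * κ * c2 +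
      (-4 * (ν : ℂ) ^ 2 * ys) * hI
  exact ⟨(mul_eq_zero.1 e1).resolve_left hne', (mul_eq_zero.1 e2).resolve_left hne'⟩

/-- The real coordinates decouple into the pairs `(xc.re, xs.im)` and `(xs.re, xc.im)`, each a 2×2
system with determinant `ν² (ν² + 2γ - 4)` up to sign. -/
theorem eq_zero_of_homographic_mode {ν γ : ℝ} {xc xs : ℂ} (hν : ν ≠ 0)
    (hne : ν ^ 2 + 2 * γ - 4 ≠ 0)
    (h1 : ν ^ 2 * xc - 2 * ν * Complex.I * xs + γ * (xc + conj xc) = 0)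
    (h2 : ν ^ 2 * xs + 2 * ν * Complex.I * xc + γ * (xs + conj xs) = 0) :
    xc = 0 ∧ xs = 0 := by
  have r1 := congrArg Complex.re h1
  have i1 := congrArg Complex.im h1
  have r2 := congrArg Complex.re h2
  have i2 := congrArg Complex.im h2
  simp [pow_two] at r1 i1 r2 i2
  have a1 : xc.re = 0 := by
    have : (ν * (ν ^ 2 + 2 * γ - 4)) * xc.re = 0 := by linear_combination ν * r1 - 2 * i2
    exact (mul_eq_zero.1 this).resolve_left (mul_ne_zero hν hne)
  have a2 : xs.re = 0 := by
    have : (ν * (ν ^ 2 + 2 * γ - 4)) * xs.re = 0 := by linear_combination ν * r2 + 2 * i1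
    exact (mul_eq_zero.1 this).resolve_left (mul_ne_zero hν hne)
  have a3 : xc.im = 0 := by
    have : ν ^ 2 * xc.im = 0 := by linear_combination i1 + 2 * ν * a2
    exact (mul_eq_zero.1 this).resolve_left (pow_ne_zero 2 hν)
  have a4 : xs.im = 0 := by
    have : ν ^ 2 * xs.im = 0 := by linear_combination i2 - 2 * ν * a1
    exact (mul_eq_zero.1 this).resolve_left (pow_ne_zero 2 hν)
  exact ⟨Complex.ext a1 a3, Complex.ext a2 a4⟩

theorem normSq_weighted_cubeRoots {ζ : ℂ} (hζ : 1 + ζ + ζ ^ 2 = 0) (hc : conj ζ = ζ ^ 2)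
    (a b c : ℝ) (h : a + b + c = 1) :
    Complex.normSq (a + b * ζ + c * ζ ^ 2) = 1 - 3 * (a * b + a * c + b * c) := by
  have h3 : ζ ^ 3 = 1 := by linear_combination (ζ - 1) * hζ
  have : ((Complex.normSq (a + b * ζ + c * ζ ^ 2) : ℝ) : ℂ) =
      ((1 - 3 * (a * b + a * c + b * c) : ℝ) : ℂ) := by
    rw [← Complex.mul_conj]
    have h' : (a : ℂ) + b + c = 1 := by exact_mod_cast h
    simp only [map_add, map_mul, map_pow, Complex.conj_ofReal, hc]
    push_cast
    linear_combination (a * b + a * c + b * c : ℂ) * hζ + (a + b + c + 1 : ℂ) * h' +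
      (b ^ 2 + c ^ 2 * (ζ ^ 3 + 1) + b * c * ζ + b * c * ζ ^ 2 + a * c * ζ : ℂ) * h3
  exact_mod_cast this

/-- Solutions of the linearized equations for the mutual differences `C j`, `S j` of a Fourier
mode, relative to a side of the triangle. -/
theorem fourierMode_differences {ζ : ℂ} (hζ : 1 + ζ + ζ ^ 2 = 0) (hc : conj ζ = ζ ^ 2)
    {a b c : ℝ} (h : a + b + c = 1) {ν γ : ℝ}
    (hne : (ν ^ 2 + γ) ^ 2 - 4 * ν ^ 2 ≠ γ ^ 2 * (1 - 3 * (a * b + a * c + b * c)))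
    {C0 C1 C2 S0 S1 S2 : ℂ} (hC : C0 + C1 + C2 = 0) (hS : S0 + S1 + S2 = 0)
    (c0 : ν ^ 2 * C0 - 2 * ν * Complex.I * S0 + γ * (C0 + conj C0) -
      γ * a * (conj C0 + ζ ^ 2 * conj C1 + ζ * conj C2) = 0)
    (c1 : ν ^ 2 * C1 - 2 * ν * Complex.I * S1 + γ * (C1 + ζ ^ 2 * conj C1) -
      γ * b * (conj C0 + ζ ^ 2 * conj C1 + ζ * conj C2) = 0)
    (c2 : ν ^ 2 * C2 - 2 * ν * Complex.I * S2 + γ * (C2 + ζ * conj C2) -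
      γ * c * (conj C0 + ζ ^ 2 * conj C1 + ζ * conj C2) = 0)
    (s0 : ν ^ 2 * S0 + 2 * ν * Complex.I * C0 + γ * (S0 + conj S0) -
      γ * a * (conj S0 + ζ ^ 2 * conj S1 + ζ * conj S2) = 0)
    (s1 : ν ^ 2 * S1 + 2 * ν * Complex.I * C1 + γ * (S1 + ζ ^ 2 * conj S1) -
      γ * b * (conj S0 + ζ ^ 2 * conj S1 + ζ * conj S2) = 0)
    (s2 : ν ^ 2 * S2 + 2 * ν * Complex.I * C2 + γ * (S2 + ζ * conj S2) -
      γ * c * (conj S0 + ζ ^ 2 * conj S1 + ζ * conj S2) = 0) :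
    ∃ xc xs : ℂ, (C0 = xc ∧ C1 = xc * ζ ∧ C2 = xc * ζ ^ 2) ∧
      (S0 = xs ∧ S1 = xs * ζ ∧ S2 = xs * ζ ^ 2) ∧
      ν ^ 2 * xc - 2 * ν * Complex.I * xs + γ * (xc + conj xc) = 0 ∧
      ν ^ 2 * xs + 2 * ν * Complex.I * xc + γ * (xs + conj xs) = 0 := by
  have h3 : ζ ^ 3 = 1 := by linear_combination (ζ - 1) * hζ
  have hcC := congrArg conj hC
  have hcS := congrArg conj hS
  simp only [map_add, map_zero] at hcC hcS
  rw [← normSq_weighted_cubeRoots hζ hc a b c h] at hne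
  -- Adding the three equations with weights `1, ζ, ζ²` gives a closed system for this combination,
  -- with `κ = a + b ζ + c ζ²`; the remaining conjugate terms add up to `conj (C0 + C1 + C2) = 0`.
  have key : (C0 + ζ * C1 + ζ ^ 2 * C2 = 0) ∧ (S0 + ζ * S1 + ζ ^ 2 * S2 = 0) := by
    refine eq_zero_of_transversal_mode hne ?_ ?_
    · simp only [map_add, map_mul, map_pow, hc]
      linear_combination c0 + ζ * c1 + ζ ^ 2 * c2 - γ * hcC -
        (γ * conj C1 + γ * conj C2) * h3 - γ * (a + b * ζ + c * ζ ^ 2) * ζ * conj C2 * h3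
    · simp only [map_add, map_mul, map_pow, hc]
      linear_combination s0 + ζ * s1 + ζ ^ 2 * s2 - γ * hcS -
        (γ * conj S1 + γ * conj S2) * h3 - γ * (a + b * ζ + c * ζ ^ 2) * ζ * conj S2 * h3
  obtain ⟨kC, kS⟩ := key
  have hζ' : ζ - ζ ^ 2 ≠ 0 := by
    intro h0
    have : (3 : ℂ) = 0 := by linear_combination -(ζ - ζ ^ 2) * h0 + hζ + (ζ - 2) * h3
    norm_num at this
  -- Two of the three discrete Fourier coefficients of `(A0, A1, A2)` vanish, so it is a multiple of
  -- `(1, ζ, ζ²)`.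
  have solve : ∀ {A0 A1 A2 : ℂ}, A0 + A1 + A2 = 0 → A0 + ζ * A1 + ζ ^ 2 * A2 = 0 →
      A1 = A0 * ζ ∧ A2 = A0 * ζ ^ 2 := by
    intro A0 A1 A2 hA kA
    have h1 : (ζ - ζ ^ 2) * (A1 - A0 * ζ) = 0 := by
      linear_combination kA - ζ ^ 2 * hA + A0 * h3
    have h2 := sub_eq_zero.1 ((mul_eq_zero.1 h1).resolve_left hζ')
    exact ⟨h2, by linear_combination hA - h2 - A0 * hζ⟩
  have cC := congrArg conj kC
  have cS := congrArg conj kS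
  simp only [map_add, map_mul, map_pow, map_zero, hc] at cC cS
  refine ⟨C0, S0, ⟨rfl, solve hC kC⟩, ⟨rfl, solve hS kS⟩, ?_, ?_⟩
  · linear_combination c0 + γ * a * cC - γ * a * ζ * conj C2 * h3
  · linear_combination s0 + γ * a * cS - γ * a * ζ * conj S2 * h3

end NBody

namespace NBody

open scoped RealInnerProductSpace ComplexConjugate

/-! ### Equilateral central configurations -/

/-- Nondegeneracy is required at every point of the orbit; this reduces it to a statement about one
arbitrary triangle. -/
theorem IsLagrangeTriangle.rotate {m : Fin 3 → ℝ} {α : ℝ} {a : Reduced m}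
    (h : IsLagrangeTriangle m α a) (θ : ℝ) :
    IsLagrangeTriangle m α (mul (Complex.exp (θ * Complex.I)) a) := by
  obtain ⟨⟨h1, h2⟩, d, hd, h3⟩ := h
  have e : ∀ k, (mul (Complex.exp (θ * Complex.I)) a).config k =
      Complex.exp (θ * Complex.I) * a.config k := fun _ => rfl
  have hn : ∀ k k', ‖(mul (Complex.exp (θ * Complex.I)) a).config k -
      (mul (Complex.exp (θ * Complex.I)) a).config k'‖ = ‖a.config k - a.config k'‖ := by
    intro k k'
    rw [e, e, ← mul_sub, norm_mul, Complex.norm_exp_ofReal_mul_I, one_mul]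
  refine ⟨⟨fun k k' hk => h1 (mul_left_cancel₀ (Complex.exp_ne_zero _) hk), fun k => ?_⟩,
    d, hd, fun i j hij => by rw [hn, h3 i j hij]⟩
  simp only [hn]
  simp only [e]
  rw [mul_left_comm, h2 k, Finset.mul_sum]
  refine Finset.sum_congr rfl fun k' _ => ?_
  ring

theorem sum_sum_Ioi_three (f : Fin 3 → Fin 3 → ℝ) :
    ∑ k, ∑ k' ∈ Finset.Ioi k, f k k' = f 0 1 + f 0 2 + f 1 2 := by
  rw [Fin.sum_univ_three, show Finset.Ioi (0 : Fin 3) = {1, 2} by decide,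
    show Finset.Ioi (1 : Fin 3) = {2} by decide, show Finset.Ioi (2 : Fin 3) = ∅ by decide]
  simp

theorem Reduced.sum_three {m : Fin 3 → ℝ} (a : Reduced m) :
    (m 0 : ℂ) * a.config 0 + m 1 * a.config 1 + m 2 * a.config 2 = 0 := by
  have h : ∑ k, (m k : ℂ) * a.config k = 0 := a.2
  rwa [Fin.sum_univ_three] at h

/-- Subtracting the equations of two bodies leaves a multiple of their difference on both sides: the
third body contributes `m 2 * (b 0 - b 1)` because all distances agree. -/
theorem IsLagrangeTriangle.rpow_side {m : Fin 3 → ℝ} {α : ℝ} {b : Reduced m} {d : ℝ}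
    (h : IsLagrangeTriangle m α b) (hm : ∀ k, 0 < m k) (hd : 0 < d)
    (hb : ∀ i j, i ≠ j → ‖b.config i - b.config j‖ = d) : d ^ (α + 1) = m 0 + m 1 + m 2 := by
  have hp : 0 < d ^ (α + 1) := Real.rpow_pos_of_pos hd _
  have h0 := h.1.2 0
  have h1 := h.1.2 1
  rw [show (Finset.univ : Finset (Fin 3)).erase 0 = {1, 2} by decide,
    Finset.sum_pair (by decide), hb 0 1 (by decide), hb 0 2 (by decide)] at h0
  rw [show (Finset.univ : Finset (Fin 3)).erase 1 = {0, 2} by decide,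
    Finset.sum_pair (by decide), hb 1 0 (by decide), hb 1 2 (by decide)] at h1
  have hp' : ((d ^ (α + 1) : ℝ) : ℂ) ≠ 0 := by exact_mod_cast hp.ne'
  have hm0 : (m 0 : ℂ) ≠ 0 := by exact_mod_cast (hm 0).ne'
  have hm1 : (m 1 : ℂ) ≠ 0 := by exact_mod_cast (hm 1).ne'
  have hne : b.config 0 - b.config 1 ≠ 0 := by
    rw [← norm_pos_iff, hb 0 1 (by decide)]
    exact hd
  simp only [Complex.ofReal_div, Complex.ofReal_mul] at h0 h1
  set D : ℂ := ((d ^ (α + 1) : ℝ) : ℂ) with hD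
  have e0 : D * b.config 0 = m 1 * (b.config 0 - b.config 1) + m 2 * (b.config 0 - b.config 2) := by
    apply mul_left_cancel₀ hm0
    field_simp at h0
    linear_combination m 0 * h0
  have e1 : D * b.config 1 = m 0 * (b.config 1 - b.config 0) + m 2 * (b.config 1 - b.config 2) := by
    apply mul_left_cancel₀ hm1
    field_simp at h1
    linear_combination m 1 * h1
  have : D * (b.config 0 - b.config 1) =
      ((m 0 + m 1 + m 2 : ℝ) : ℂ) * (b.config 0 - b.config 1) := by
    push_cast
    linear_combination e0 - e1
  exact Complex.ofReal_injective (mul_right_cancel₀ hne this)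

theorem mode_difference {m0 m1 m2 i e : ℝ} (h1 : m1 ≠ 0) (h2 : m2 ≠ 0)
    (hi : i * (m0 + m1 + m2) = 1) {X0 X1 X2 c0 c1 c2 b0 b1 b2 : ℂ}
    (H : ∀ w0 w1 w2 : ℂ, m0 * w0 + m1 * w1 + m2 * w2 = 0 →
      m0 * ⟪X0, w0⟫ + m1 * ⟪X1, w1⟫ + m2 * ⟪X2, w2⟫ +
      m0 * m1 * (-i * ⟪c0 - c1, w0 - w1⟫ + e * ⟪b0 - b1, c0 - c1⟫ * ⟪b0 - b1, w0 - w1⟫) +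
      m1 * m2 * (-i * ⟪c1 - c2, w1 - w2⟫ + e * ⟪b1 - b2, c1 - c2⟫ * ⟪b1 - b2, w1 - w2⟫) +
      m2 * m0 * (-i * ⟪c2 - c0, w2 - w0⟫ + e * ⟪b2 - b0, c2 - c0⟫ * ⟪b2 - b0, w2 - w0⟫) = 0) :
    X1 - X2 - (c1 - c2) + (e * (m0 + m1 + m2) * ⟪b1 - b2, c1 - c2⟫ : ℝ) * (b1 - b2) -
      (e * m0 : ℝ) * ((⟪b1 - b2, c1 - c2⟫ : ℝ) * (b1 - b2) + (⟪b2 - b0, c2 - c0⟫ : ℝ) * (b2 - b0) +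
        (⟪b0 - b1, c0 - c1⟫ : ℝ) * (b0 - b1)) = 0 := by
  -- This variation keeps the center of mass and moves only two bodies, so it isolates the
  -- difference of their equations; `z = 1` and `z = I` give its real and imaginary parts.
  have H' : ∀ z : ℂ, _ := fun z => H 0 (m2 * z) (-(m1 * z)) (by ring)
  have hr := H' 1
  have hi' := H' Complex.I
  apply Complex.ext
  · simp only [Complex.inner] at hr ⊢
    simp at hr ⊢
    apply mul_left_cancel₀ (mul_ne_zero h1 h2)
    linear_combination hr + m1 * m2 * (c1.re - c2.re) * hi
  · simp only [Complex.inner] at hi' ⊢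
    simp at hi' ⊢
    apply mul_left_cancel₀ (mul_ne_zero h1 h2)
    linear_combination hi' + m1 * m2 * (c1.im - c2.im) * hi

/-- Both vanishing identities come from `∑_{k<k'} m_k m_k' ⟪x_k - x_k', v_k - v_k'⟫ = (∑ m_k) ∑ m_k
⟪x_k, v_k⟫` for centered configurations. In the direction `J b` the rank-one terms of the Hessian
drop out, since `J` turns each side into an orthogonal vector. -/
theorem IsLagrangeTriangle.hasHessianAt_potential {m : Fin 3 → ℝ} {α : ℝ} {b : Reduced m} {d : ℝ}
    (h : IsLagrangeTriangle m α b) (hm : ∀ k, 0 < m k) (hd : 0 < d)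
    (hb : ∀ i j, i ≠ j → ‖b.config i - b.config j‖ = d) :
    ∃ U' B, HasHessianAt (potential m α) U' B b.config ∧
      (∀ v : Reduced m, ∑ k, m k * ⟪v.config k, b.config k⟫ + U' v.config = 0) ∧
      (∀ v : Reduced m, ∑ k, m k * ⟪v.config k, (mul Complex.I b).config k⟫ +
        B (mul Complex.I b).config v.config = 0) ∧
      ∀ y z, B y z =
        m 0 * m 1 * (-(m 0 + m 1 + m 2)⁻¹ * ⟪y 0 - y 1, z 0 - z 1⟫ +
          (α + 1) * ((m 0 + m 1 + m 2)⁻¹ / d ^ 2) * ⟪b.config 0 - b.config 1, y 0 - y 1⟫ *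
            ⟪b.config 0 - b.config 1, z 0 - z 1⟫) +
        m 0 * m 2 * (-(m 0 + m 1 + m 2)⁻¹ * ⟪y 0 - y 2, z 0 - z 2⟫ +
          (α + 1) * ((m 0 + m 1 + m 2)⁻¹ / d ^ 2) * ⟪b.config 0 - b.config 2, y 0 - y 2⟫ *
            ⟪b.config 0 - b.config 2, z 0 - z 2⟫) +
        m 1 * m 2 * (-(m 0 + m 1 + m 2)⁻¹ * ⟪y 1 - y 2, z 1 - z 2⟫ +
          (α + 1) * ((m 0 + m 1 + m 2)⁻¹ / d ^ 2) * ⟪b.config 1 - b.config 2, y 1 - y 2⟫ *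
            ⟪b.config 1 - b.config 2, z 1 - z 2⟫) := by
  obtain ⟨U', B, hU, hU', hB⟩ := NBody.hasHessianAt_potential m α h.1.1
  have r1 : d ^ (-(α + 1)) = (m 0 + m 1 + m 2)⁻¹ := by
    rw [Real.rpow_neg hd.le, h.rpow_side hm hd hb]
  have r2 : d ^ (-(α + 3)) = (m 0 + m 1 + m 2)⁻¹ / d ^ 2 := by
    rw [← r1, show -(α + 3) = -(α + 1) - (2 : ℕ) by push_cast; ring, Real.rpow_sub_natCast hd.ne']
  have hM : (m 0 + m 1 + m 2)⁻¹ * (m 0 + m 1 + m 2) = 1 :=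
    inv_mul_cancel₀ (by linarith [hm 0, hm 1, hm 2])
  simp only [sum_sum_Ioi_three, hb 0 1 (by decide), hb 0 2 (by decide), hb 1 2 (by decide), r1,
    r2] at hU' hB
  have e : ∀ k, (mul Complex.I b).config k = Complex.I * b.config k := fun _ => rfl
  refine ⟨U', B, hU, fun v => ?_, fun v => ?_, hB⟩
  · have hr := congrArg Complex.re v.sum_three
    have hi := congrArg Complex.im v.sum_three
    simp at hr hi
    rw [hU', Fin.sum_univ_three]
    simp only [Complex.inner]
    generalize (m 0 + m 1 + m 2)⁻¹ = i at hM
    simp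
    linear_combination (-(m 0 * (v.config 0).re * (b.config 0).re + m 1 * (v.config 1).re *
        (b.config 1).re + m 2 * (v.config 2).re * (b.config 2).re + m 0 * (v.config 0).im *
        (b.config 0).im + m 1 * (v.config 1).im * (b.config 1).im + m 2 * (v.config 2).im *
        (b.config 2).im)) * hM +
      i * (m 0 * (b.config 0).re + m 1 * (b.config 1).re + m 2 * (b.config 2).re) * hr +
      i * (m 0 * (b.config 0).im + m 1 * (b.config 1).im + m 2 * (b.config 2).im) * hi
  · have hr := congrArg Complex.re v.sum_three
    have hi := congrArg Complex.im v.sum_three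
    simp at hr hi
    rw [hB, Fin.sum_univ_three]
    simp only [e, Complex.inner]
    generalize (m 0 + m 1 + m 2)⁻¹ = i at hM
    simp
    linear_combination (m 0 * (v.config 0).re * (b.config 0).im + m 1 * (v.config 1).re *
        (b.config 1).im + m 2 * (v.config 2).re * (b.config 2).im - m 0 * (v.config 0).im * (b.config 0).re -
        m 1 * (v.config 1).im * (b.config 1).re - m 2 * (v.config 2).im * (b.config 2).re) * hM -
      i * (m 0 * (b.config 0).im + m 1 * (b.config 1).im + m 2 * (b.config 2).im) * hr +
      i * (m 0 * (b.config 0).re + m 1 * (b.config 1).re + m 2 * (b.config 2).re) * hi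

end NBody

/-! ### Mode equations in units of one side -/

namespace NBody

open scoped RealInnerProductSpace ComplexConjugate

/-- Orthogonal projection onto the line of `ξ z` is the average of the identity and the reflection
in that line; in the coordinate `C` the reflection is `C ↦ ξ² conj C`. -/
theorem ofReal_inner_mul_self {z ξ : ℂ} {d : ℝ} (hz : z * conj z = (d : ℂ) ^ 2)
    (hξ : ξ * conj ξ = 1) (C : ℂ) :
    ((⟪ξ * z, z * C⟫ : ℝ) : ℂ) * (ξ * z) = (d : ℂ) ^ 2 / 2 * z * (C + ξ ^ 2 * conj C) := by
  have : ((⟪ξ * z, z * C⟫ : ℝ) : ℂ) = (conj (ξ * z) * (z * C) + ξ * z * conj (z * C)) / 2 := by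
    rw [Complex.inner, Complex.re_eq_add_conj]
    simp only [map_mul, Complex.conj_conj]
    ring
  rw [this]
  simp only [map_mul]
  linear_combination (z * C * ξ * conj ξ / 2 + ξ ^ 2 * z * conj C / 2) * hz +
    (d : ℂ) ^ 2 / 2 * z * C * hξ

/-- The linearized equation of a Fourier mode `c cos + s sin` of frequency `ν` about a triangle with
vertices `b0`, `b1`, `b2` and side `d`, in weak form. -/
def ModeEquation (m0 m1 m2 α d ν : ℝ) (b0 b1 b2 c0 c1 c2 s0 s1 s2 : ℂ) : Prop :=
  ∀ w0 w1 w2 : ℂ, m0 * w0 + m1 * w1 + m2 * w2 = 0 →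
      m0 * ⟪((ν : ℂ) ^ 2 + 1) * c0 - 2 * ν * Complex.I * s0, w0⟫ +
      m1 * ⟪((ν : ℂ) ^ 2 + 1) * c1 - 2 * ν * Complex.I * s1, w1⟫ +
      m2 * ⟪((ν : ℂ) ^ 2 + 1) * c2 - 2 * ν * Complex.I * s2, w2⟫ +
      m0 * m1 * (-(m0 + m1 + m2)⁻¹ * ⟪c0 - c1, w0 - w1⟫ +
        (α + 1) * ((m0 + m1 + m2)⁻¹ / d ^ 2) * ⟪b0 - b1, c0 - c1⟫ * ⟪b0 - b1, w0 - w1⟫) +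
      m1 * m2 * (-(m0 + m1 + m2)⁻¹ * ⟪c1 - c2, w1 - w2⟫ +
        (α + 1) * ((m0 + m1 + m2)⁻¹ / d ^ 2) * ⟪b1 - b2, c1 - c2⟫ * ⟪b1 - b2, w1 - w2⟫) +
      m2 * m0 * (-(m0 + m1 + m2)⁻¹ * ⟪c2 - c0, w2 - w0⟫ +
        (α + 1) * ((m0 + m1 + m2)⁻¹ / d ^ 2) * ⟪b2 - b0, c2 - c0⟫ * ⟪b2 - b0, w2 - w0⟫) = 0

theorem ModeEquation.rotate {m0 m1 m2 α d ν : ℝ} {b0 b1 b2 c0 c1 c2 s0 s1 s2 : ℂ}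
    (H : ModeEquation m0 m1 m2 α d ν b0 b1 b2 c0 c1 c2 s0 s1 s2) :
    ModeEquation m1 m2 m0 α d ν b1 b2 b0 c1 c2 c0 s1 s2 s0 := by
  intro w1 w2 w0 hw
  rw [show m1 + m2 + m0 = m0 + m1 + m2 by ring]
  linear_combination H w0 w1 w2 (by linear_combination hw)

/-- The unit `z` is separate from the side `ξ z` of the equation, so that the three cyclic instances
share the same unknowns. The powers of `d` cancel, and the isotropic part of the Hessian turns `ν² +
1` into `ν²`. -/
theorem mode_difference_normalized {m0 m1 m2 α d ν : ℝ} (h1 : m1 ≠ 0) (h2 : m2 ≠ 0)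
    (hM : m0 + m1 + m2 ≠ 0) (hd : d ≠ 0) {z ζ ξ : ℂ} (hz : z * conj z = (d : ℂ) ^ 2)
    (hζ : ζ * conj ζ = 1) (hξ : ξ * conj ξ = 1) {b0 b1 b2 c0 c1 c2 s0 s1 s2 : ℂ}
    (hb0 : b1 - b2 = ξ * z) (hb1 : b2 - b0 = ξ * ζ * z) (hb2 : b0 - b1 = ξ * ζ ^ 2 * z)
    (H : ModeEquation m0 m1 m2 α d ν b0 b1 b2 c0 c1 c2 s0 s1 s2) :
    ν ^ 2 * ((c1 - c2) / z) - 2 * ν * Complex.I * ((s1 - s2) / z) +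
      ((α + 1) / 2 : ℝ) * ((c1 - c2) / z + ξ ^ 2 * conj ((c1 - c2) / z)) -
      ((α + 1) / 2 : ℝ) * (m0 / (m0 + m1 + m2) : ℝ) * ξ ^ 2 * (conj ((c1 - c2) / z) +
        ζ ^ 2 * conj ((c2 - c0) / z) + ζ ^ 4 * conj ((c0 - c1) / z)) = 0 := by
  have hd' : (d : ℂ) ≠ 0 := by exact_mod_cast hd
  have hz0 : z ≠ 0 := by
    rintro rfl
    rw [zero_mul] at hz
    exact pow_ne_zero 2 hd' hz.symm
  have key := mode_difference h1 h2 (inv_mul_cancel₀ hM) H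
  obtain ⟨C0, hC0⟩ : ∃ C, C = (c1 - c2) / z := ⟨_, rfl⟩
  obtain ⟨C1, hC1⟩ : ∃ C, C = (c2 - c0) / z := ⟨_, rfl⟩
  obtain ⟨C2, hC2⟩ : ∃ C, C = (c0 - c1) / z := ⟨_, rfl⟩
  obtain ⟨S0, hS0⟩ : ∃ C, C = (s1 - s2) / z := ⟨_, rfl⟩
  rw [← hC0, ← hC1, ← hC2, ← hS0]
  rw [eq_div_iff hz0, mul_comm] at hC0 hC1 hC2 hS0
  have hξ1 : (ξ * ζ) * conj (ξ * ζ) = 1 := by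
    rw [map_mul]; linear_combination (ζ * conj ζ) * hξ + hζ
  have hξ2 : (ξ * ζ ^ 2) * conj (ξ * ζ ^ 2) = 1 := by
    rw [map_mul, map_pow]; linear_combination (ζ ^ 2 * conj ζ ^ 2) * hξ + (ζ * conj ζ + 1) * hζ
  have p0 := ofReal_inner_mul_self hz hξ C0
  have p1 := ofReal_inner_mul_self hz hξ1 C1
  have p2 := ofReal_inner_mul_self hz hξ2 C2
  rw [← hC0, ← hC1, ← hC2, hb0, hb1, hb2, Complex.ofReal_mul _ (inner ℝ _ _), mul_assoc _ _ (ξ * z),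
    p0, p1, p2] at key
  have hsum : z * (C0 + C1 + C2) = 0 := by linear_combination hC0 + hC1 + hC2
  have hM' : (m0 + m1 + m2 : ℂ) ≠ 0 := by exact_mod_cast hM
  apply mul_left_cancel₀ hz0
  push_cast at key ⊢
  have k1 : ((α : ℂ) + 1) * ((m0 + m1 + m2 : ℂ)⁻¹ / d ^ 2) * (m0 + m1 + m2) * (d ^ 2 / 2) =
      (α + 1) / 2 := by field_simp
  have k2 : ((α : ℂ) + 1) * ((m0 + m1 + m2 : ℂ)⁻¹ / d ^ 2) * m0 * (d ^ 2 / 2) =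
      (α + 1) / 2 * (m0 / (m0 + m1 + m2)) := by field_simp
  linear_combination key + ((ν : ℂ) ^ 2 + 1) * hC0 - 2 * ν * Complex.I * hS0 -
    z * (C0 + ξ ^ 2 * conj C0) * k1 + z * (C0 + C1 + C2 + ξ ^ 2 * (conj C0 + ζ ^ 2 * conj C1 +
      ζ ^ 4 * conj C2)) * k2 + (α + 1) / 2 * (m0 / (m0 + m1 + m2)) * hsum

/-- The ratio `ζ` of two sides satisfies `|ζ| = |1 + ζ| = 1`, which forces `1 + ζ + ζ² = 0`. Both
orientations of the triangle are covered, as the choice of root is left open. -/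
theorem exists_cubeRoot_sides {b0 b1 b2 : ℂ} {d : ℝ} (hd : 0 < d) (h0 : ‖b1 - b2‖ = d)
    (h1 : ‖b2 - b0‖ = d) (h2 : ‖b0 - b1‖ = d) :
    ∃ ζ : ℂ, 1 + ζ + ζ ^ 2 = 0 ∧ conj ζ = ζ ^ 2 ∧ b2 - b0 = ζ * (b1 - b2) ∧
      b0 - b1 = ζ ^ 2 * (b1 - b2) := by
  have hz : b1 - b2 ≠ 0 := by rw [← norm_pos_iff, h0]; exact hd
  obtain ⟨ζ, hζ⟩ : ∃ ζ, ζ = (b2 - b0) / (b1 - b2) := ⟨_, rfl⟩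
  have e1 : ζ * conj ζ = 1 := by
    rw [Complex.mul_conj, Complex.normSq_eq_norm_sq, hζ, norm_div, h0, h1, div_self hd.ne']
    norm_num
  have e2 : (1 + ζ) * conj (1 + ζ) = 1 := by
    have : 1 + ζ = -((b0 - b1) / (b1 - b2)) := by
      rw [hζ]
      field_simp
      ring
    rw [Complex.mul_conj, Complex.normSq_eq_norm_sq, this, norm_neg, norm_div, h0, h2,
      div_self hd.ne']
    norm_num
  rw [map_add, map_one] at e2
  have e3 : 1 + ζ + ζ ^ 2 = 0 := by linear_combination ζ * e2 - (1 + ζ) * e1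
  rw [eq_div_iff hz] at hζ
  refine ⟨ζ, e3, by linear_combination e2 - e1 - e3, hζ.symm, ?_⟩
  linear_combination hζ - (b1 - b2) * e3

theorem Reduced.eq_zero_of_differences {m : Fin 3 → ℝ} (hm : ∀ k, 0 < m k) {c : Reduced m}
    (h0 : c.config 1 - c.config 2 = 0) (h2 : c.config 0 - c.config 1 = 0) : c = 0 := by
  have hM : (m 0 + m 1 + m 2 : ℂ) ≠ 0 := by
    exact_mod_cast (by linarith [hm 0, hm 1, hm 2] : 0 < m 0 + m 1 + m 2).ne'
  have h1 : c.config 1 = 0 := by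
    have : (m 0 + m 1 + m 2 : ℂ) * c.config 1 = 0 := by
      linear_combination c.sum_three - m 0 * h2 + m 2 * h0
    exact (mul_eq_zero.1 this).resolve_left hM
  rw [h1, zero_sub, neg_eq_zero] at h0
  rw [h1, sub_zero] at h2
  apply Subtype.ext
  change c.config = 0
  ext k
  fin_cases k
  exacts [h2, h1, h0]

/-- The Fourier modes of the kernel of the Hessian at a Lagrange triangle. -/
theorem IsLagrangeTriangle.mode_eq {m : Fin 3 → ℝ} {α β : ℝ} {b : Reduced m} {d : ℝ}
    (hm : ∀ k, 0 < m k) (hα : 1 ≤ α)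
    (hβ : β = 27 * (m 0 * m 1 + m 0 * m 2 + m 1 * m 2) / (m 0 + m 1 + m 2) ^ 2)
    (hαβ : 9 * ((3 - α) / (1 + α)) ^ 2 < β) (hd : 0 < d)
    (hb : ∀ i j, i ≠ j → ‖b.config i - b.config j‖ = d)
    {B : PiLp 2 (fun _ : Fin 3 => ℂ) →L[ℝ] PiLp 2 (fun _ : Fin 3 => ℂ) →L[ℝ] ℝ}
    (hB : ∀ y z, B y z =
        m 0 * m 1 * (-(m 0 + m 1 + m 2)⁻¹ * ⟪y 0 - y 1, z 0 - z 1⟫ +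
          (α + 1) * ((m 0 + m 1 + m 2)⁻¹ / d ^ 2) * ⟪b.config 0 - b.config 1, y 0 - y 1⟫ *
            ⟪b.config 0 - b.config 1, z 0 - z 1⟫) +
        m 0 * m 2 * (-(m 0 + m 1 + m 2)⁻¹ * ⟪y 0 - y 2, z 0 - z 2⟫ +
          (α + 1) * ((m 0 + m 1 + m 2)⁻¹ / d ^ 2) * ⟪b.config 0 - b.config 2, y 0 - y 2⟫ *
            ⟪b.config 0 - b.config 2, z 0 - z 2⟫) +
        m 1 * m 2 * (-(m 0 + m 1 + m 2)⁻¹ * ⟪y 1 - y 2, z 1 - z 2⟫ +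
          (α + 1) * ((m 0 + m 1 + m 2)⁻¹ / d ^ 2) * ⟪b.config 1 - b.config 2, y 1 - y 2⟫ *
            ⟪b.config 1 - b.config 2, z 1 - z 2⟫))
    {ν : ℝ} {c s : Reduced m}
    (Hc : ∀ w : Reduced m, ∑ k, m k * ⟪((ν : ℂ) ^ 2 + 1) * c.config k -
      2 * ν * Complex.I * s.config k, w.config k⟫ + B c.config w.config = 0)
    (Hs : ∀ w : Reduced m, ∑ k, m k * ⟪((ν : ℂ) ^ 2 + 1) * s.config k +
      2 * ν * Complex.I * c.config k, w.config k⟫ + B s.config w.config = 0) :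
    (ν ≠ 0 → ν ^ 2 ≠ 3 - α → c = 0 ∧ s = 0) ∧ (ν = 0 → ∃ r : ℝ, c = r • mul Complex.I b) := by
  obtain ⟨ζ, hζ, hζc, hb1, hb2⟩ := exists_cubeRoot_sides hd (hb 1 2 (by decide))
    (hb 2 0 (by decide)) (hb 0 1 (by decide))
  obtain ⟨z, hzdef⟩ : ∃ z, z = b.config 1 - b.config 2 := ⟨_, rfl⟩
  rw [← hzdef] at hb1 hb2
  have hz : z * conj z = (d : ℂ) ^ 2 := by
    rw [Complex.mul_conj, Complex.normSq_eq_norm_sq, hzdef, hb 1 2 (by decide)]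
    norm_cast
  have hz0 : z ≠ 0 := by rw [hzdef, ← norm_pos_iff, hb 1 2 (by decide)]; exact hd
  have hζ3 : ζ ^ 3 = 1 := by linear_combination (ζ - 1) * hζ
  have hζn : ζ * conj ζ = 1 := by rw [hζc]; linear_combination hζ3
  have hM0 : 0 < m 0 + m 1 + m 2 := by linarith [hm 0, hm 1, hm 2]
  have eqs : ∀ {ν : ℝ} {c s : Reduced m}, (∀ w : Reduced m, ∑ k, m k * ⟪((ν : ℂ) ^ 2 + 1) *
      c.config k - 2 * ν * Complex.I * s.config k, w.config k⟫ + B c.config w.config = 0) →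
      ModeEquation (m 0) (m 1) (m 2) α d ν (b.config 0) (b.config 1) (b.config 2) (c.config 0)
        (c.config 1) (c.config 2) (s.config 0) (s.config 1) (s.config 2) := by
    intro ν c s H w0 w1 w2 hw
    obtain ⟨w, rfl, rfl, rfl⟩ : ∃ w : Reduced m, w.config 0 = w0 ∧ w.config 1 = w1 ∧
        w.config 2 = w2 := by
      refine ⟨⟨WithLp.toLp 2 ![w0, w1, w2], ?_⟩, rfl, rfl, rfl⟩
      change ∑ k, (m k : ℂ) * (![w0, w1, w2] : Fin 3 → ℂ) k = 0
      simpa [Fin.sum_univ_three] using hw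
    have := H w
    rw [hB, Fin.sum_univ_three] at this
    rw [← neg_sub (c.config 0) (c.config 2), ← neg_sub (b.config 0) (b.config 2),
      ← neg_sub (w.config 0) (w.config 2)]
    simp only [inner_neg_neg]
    rw [mul_comm (m 2) (m 0)]
    linear_combination this
  have hζ2 : (ζ ^ 2) * conj (ζ ^ 2) = 1 := by
    rw [map_pow]; linear_combination (ζ * conj ζ + 1) * hζn
  have Ec := eqs Hc
  -- The sine equation is the cosine equation with `c`, `s` exchanged and the frequency reversed.
  have Es := eqs (ν := -ν) (c := s) (s := c) fun w => by
    rw [← Hs w]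
    push_cast
    congr 2
    funext k
    congr 2
    ring
  have c0 := mode_difference_normalized (hm 1).ne' (hm 2).ne' hM0.ne' hd.ne' hz hζn (ξ := 1)
    (by simp) (hzdef.symm.trans (one_mul z).symm) (hb1.trans (by ring)) (hb2.trans (by ring)) Ec
  have s0 := mode_difference_normalized (hm 1).ne' (hm 2).ne' hM0.ne' hd.ne' hz hζn (ξ := 1)
    (by simp) (hzdef.symm.trans (one_mul z).symm) (hb1.trans (by ring)) (hb2.trans (by ring)) Es
  have c1 := mode_difference_normalized (hm 2).ne' (hm 0).ne' (by linarith) hd.ne' hz hζn hζn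
    hb1 (hb2.trans (by ring)) (hzdef.symm.trans (by linear_combination -z * hζ3)) Ec.rotate
  have s1 := mode_difference_normalized (hm 2).ne' (hm 0).ne' (by linarith) hd.ne' hz hζn hζn
    hb1 (hb2.trans (by ring)) (hzdef.symm.trans (by linear_combination -z * hζ3)) Es.rotate
  have c2 := mode_difference_normalized (hm 0).ne' (hm 1).ne' (by linarith) hd.ne' hz hζn hζ2
    hb2 (hzdef.symm.trans (by linear_combination -z * hζ3))
    (hb1.trans (by linear_combination -ζ * z * hζ3)) Ec.rotate.rotate
  have s2 := mode_difference_normalized (hm 0).ne' (hm 1).ne' (by linarith) hd.ne' hz hζn hζ2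
    hb2 (hzdef.symm.trans (by linear_combination -z * hζ3))
    (hb1.trans (by linear_combination -ζ * z * hζ3)) Es.rotate.rotate
  rw [show m 1 + m 2 + m 0 = m 0 + m 1 + m 2 by ring] at c1 s1
  rw [show m 2 + m 0 + m 1 = m 0 + m 1 + m 2 by ring] at c2 s2
  obtain ⟨C0, hC0⟩ : ∃ C, C = (c.config 1 - c.config 2) / z := ⟨_, rfl⟩
  obtain ⟨C1, hC1⟩ : ∃ C, C = (c.config 2 - c.config 0) / z := ⟨_, rfl⟩
  obtain ⟨C2, hC2⟩ : ∃ C, C = (c.config 0 - c.config 1) / z := ⟨_, rfl⟩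
  obtain ⟨S0, hS0⟩ : ∃ C, C = (s.config 1 - s.config 2) / z := ⟨_, rfl⟩
  obtain ⟨S1, hS1⟩ : ∃ C, C = (s.config 2 - s.config 0) / z := ⟨_, rfl⟩
  obtain ⟨S2, hS2⟩ : ∃ C, C = (s.config 0 - s.config 1) / z := ⟨_, rfl⟩
  simp only [← hC0, ← hC1, ← hC2, ← hS0, ← hS1, ← hS2, Complex.ofReal_neg] at c0 c1 c2 s0 s1 s2
  rw [eq_div_iff hz0] at hC0 hC1 hC2 hS0 hS1 hS2
  obtain ⟨γ, hγ⟩ : ∃ γ : ℝ, γ = (α + 1) / 2 := ⟨_, rfl⟩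
  obtain ⟨x0, hx0⟩ : ∃ x : ℝ, x = m 0 / (m 0 + m 1 + m 2) := ⟨_, rfl⟩
  obtain ⟨x1, hx1⟩ : ∃ x : ℝ, x = m 1 / (m 0 + m 1 + m 2) := ⟨_, rfl⟩
  obtain ⟨x2, hx2⟩ : ∃ x : ℝ, x = m 2 / (m 0 + m 1 + m 2) := ⟨_, rfl⟩
  rw [← hγ, ← hx0] at c0 s0
  rw [← hγ, ← hx1] at c1 s1
  rw [← hγ, ← hx2] at c2 s2
  have hx : x0 + x1 + x2 = 1 := by
    rw [hx0, hx1, hx2]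
    field_simp
  have hβx : β = 27 * (x0 * x1 + x0 * x2 + x1 * x2) := by
    rw [hβ, hx0, hx1, hx2]
    field_simp
  have hne : (ν ^ 2 + γ) ^ 2 - 4 * ν ^ 2 ≠
      γ ^ 2 * (1 - 3 * (x0 * x1 + x0 * x2 + x1 * x2)) := by
    have h1 : 9 * (3 - α) ^ 2 < β * (1 + α) ^ 2 := by
      rwa [div_pow, mul_div_assoc', div_lt_iff₀ (by positivity)] at hαβ
    rw [hβx] at h1
    rw [hγ]
    -- Completing the square in `ν²`: the remaining constant `(β (1 + α)² - 9 (3 - α)²) / 36` is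
    -- positive by `h1`.
    have h2 := sq_nonneg (ν ^ 2 + (α - 3) / 2)
    intro h3
    linarith
  obtain ⟨xc, xs, ⟨e0, e1, e2⟩, ⟨f0, f1, f2⟩, g1, g2⟩ := fourierMode_differences hζ hζc hx hne
    (C0 := C0) (C1 := C1) (C2 := C2) (S0 := S0) (S1 := S1) (S2 := S2)
    (by apply mul_right_cancel₀ hz0; linear_combination hC0 + hC1 + hC2)
    (by apply mul_right_cancel₀ hz0; linear_combination hS0 + hS1 + hS2)
    (by linear_combination c0 + γ * x0 * ζ * conj C2 * hζ3)
    (by linear_combination c1 + γ * x1 * (ζ * conj C2 + (ζ ^ 3 + 1) * conj C0) * hζ3)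
    (by linear_combination c2 + (γ * x2 * (ζ * conj C2 + (ζ ^ 3 + 1) * conj C0 +
      ζ ^ 2 * (ζ ^ 3 + 1) * conj C1) - γ * ζ * conj C2) * hζ3)
    (by linear_combination s0 + γ * x0 * ζ * conj S2 * hζ3)
    (by linear_combination s1 + γ * x1 * (ζ * conj S2 + (ζ ^ 3 + 1) * conj S0) * hζ3)
    (by linear_combination s2 + (γ * x2 * (ζ * conj S2 + (ζ ^ 3 + 1) * conj S0 +
      ζ ^ 2 * (ζ ^ 3 + 1) * conj S1) - γ * ζ * conj S2) * hζ3)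
  refine ⟨fun hν hν' => ?_, fun hν => ⟨xc.im, ?_⟩⟩
  · obtain ⟨rfl, rfl⟩ := eq_zero_of_homographic_mode hν
      (fun h => hν' (by rw [hγ] at h; linarith)) g1 g2
    constructor
    · refine Reduced.eq_zero_of_differences hm ?_ ?_
      · rw [← hC0, e0, zero_mul]
      · rw [← hC2, e2, zero_mul, zero_mul]
    · refine Reduced.eq_zero_of_differences hm ?_ ?_
      · rw [← hS0, f0, zero_mul]
      · rw [← hS2, f2, zero_mul, zero_mul]
  · have hγ0 : (γ : ℂ) ≠ 0 := by
      have : 0 < γ := by rw [hγ]; linarith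
      exact_mod_cast this.ne'
    -- At frequency zero the equation only says that `xc` has no real part: dilations are excluded
    -- and rotations remain.
    have hxc : xc = xc.im * Complex.I := by
      rw [hν] at g1
      have h1 : (γ : ℂ) * (xc + conj xc) = 0 := by simpa using g1
      have h2 := congrArg Complex.re ((mul_eq_zero.1 h1).resolve_left hγ0)
      simp at h2
      apply Complex.ext <;> simp [h2]
    rw [← sub_eq_zero]
    have e : ∀ k, (c - xc.im • mul Complex.I b).config k =
        c.config k - xc.im * (Complex.I * b.config k) := fun k => by
      rw [← Complex.real_smul]
      rfl
    refine Reduced.eq_zero_of_differences hm ?_ ?_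
    · rw [e, e]
      linear_combination -hC0 + z * e0 + z * hxc + xc.im * Complex.I * hzdef
    · rw [e, e]
      linear_combination -hC2 + z * e2 + z * ζ ^ 2 * hxc - xc.im * Complex.I * hb2

end NBody

/-! ### Means and Fourier coefficients of periodic paths -/

namespace Sobolev

variable {F : Type*} [NormedAddCommGroup F] [NormedSpace ℝ F]

theorem cosS_zero (s : S1) : cosS 0 s = 1 := by simp only [cosS, fourier_zero, Complex.one_re]

theorem sinS_zero (s : S1) : sinS 0 s = 0 := by simp only [sinS, fourier_zero, Complex.one_im]

theorem integral_path_constPath [CompleteSpace F] (a : F) :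
    ∫ s, path (constPath a) s = (2 * π) • a := by
  rw [integral_congr_ae (path_constPath a), integral_const, measureReal_def,
    AddCircle.measure_univ, ENNReal.toReal_ofReal Real.two_pi_pos.le]

/-- Translating by `h` preserves the integral, yet multiplies it by `fourier (-n) h ≠ 1`. -/
theorem fourierCoeff_eq_zero_of_periodic {f : S1 → ℂ} {h : S1} {n : ℤ}
    (hf : (fun s => f (s + h)) =ᵐ[volume] f) (hn : fourier (-n) h ≠ 1) : fourierCoeff f n = 0 := by
  rw [fourierCoeff, AddCircle.integral_haarAddCircle]
  have e1 : ∫ s, fourier (-n) s • f s = ∫ s, fourier (-n) (s + h) • f (s + h) :=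
    (integral_add_right_eq_self (fun s => fourier (-n) s • f s) h).symm
  have e2 : ∫ s, fourier (-n) (s + h) • f (s + h) =
      fourier (-n) h * ∫ s, fourier (-n) s • f s := by
    rw [← integral_const_mul]
    refine integral_congr_ae ?_
    filter_upwards [hf] with s hs
    rw [hs, smul_eq_mul, smul_eq_mul, ← mul_assoc]
    congr 1
    simp only [fourier_apply, smul_add, AddCircle.toCircle_add, Circle.coe_mul]
    ring
  rw [e2] at e1
  have : (1 - fourier (-n) h) * ∫ s, fourier (-n) s • f s = 0 := by linear_combination e1
  rw [(mul_eq_zero.1 this).resolve_left (sub_ne_zero.2 hn.symm), smul_zero]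

theorem fourier_two_pi_div_eq_one_iff {l : ℕ} (hl : l ≠ 0) (n : ℤ) :
    fourier n ((2 * π / l : ℝ) : S1) = 1 ↔ (l : ℤ) ∣ n := by
  rw [fourier_coe_eq, Complex.exp_eq_one_iff]
  have hπ : (π : ℂ) ≠ 0 := by exact_mod_cast Real.pi_ne_zero
  have hl' : (l : ℂ) ≠ 0 := by exact_mod_cast hl
  constructor
  · rintro ⟨k, hk⟩
    refine ⟨k, ?_⟩
    push_cast at hk
    have hI := Complex.I_ne_zero
    field_simp at hk
    have : (n : ℂ) = l * k := by linear_combination hk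
    exact_mod_cast this
  · rintro ⟨k, rfl⟩
    refine ⟨k, ?_⟩
    push_cast
    field_simp

end Sobolev

/-! ### From Fourier modes to the kernel of the Hessian -/

namespace NBody

open Sobolev
open scoped RealInnerProductSpace

/-- The coefficients of the path suffice, because those of the velocity are their multiples by `i
j`. -/
theorem eq_zero_of_fourierCoeff {n : ℕ} {m : Fin n → ℝ} {u : H1 (Reduced m)}
    (h : ∀ k j, fourierCoeff (fun s => positionL m k (path u s)) j = 0) : u = 0 := by
  have e : ∀ f : S1 → Reduced m, (∀ k, (fun s => positionL m k (f s)) =ᵐ[volume] fun _ => 0) →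
      f =ᵐ[volume] fun _ => 0 := by
    intro f hf
    filter_upwards [ae_all_iff.2 hf] with s hs
    apply Subtype.ext
    change (f s).config = 0
    ext k
    exact hs k
  have hp : ∀ k, MemLp (fun s => positionL m k (path u s)) 2 volume := fun k =>
    (positionL m k).comp_memLp' (Lp.memLp u.1.fst)
  have hv : ∀ k, MemLp (fun s => positionL m k (vel u s)) 2 volume := fun k =>
    (positionL m k).comp_memLp' (Lp.memLp u.1.snd)
  have h0 : path (0 : H1 (Reduced m)) =ᵐ[volume] fun _ => 0 := Lp.coeFn_zero _ _ _
  have h0' : vel (0 : H1 (Reduced m)) =ᵐ[volume] fun _ => 0 := Lp.coeFn_zero _ _ _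
  refine H1.ext ((e _ fun k => ?_).trans h0.symm) ((e _ fun k => ?_).trans h0'.symm)
  · exact ae_eq_zero_of_fourierCoeff (hp k) (h k)
  · exact ae_eq_zero_of_fourierCoeff (hv k) fun j => by rw [fourierCoeff_vel, h, mul_zero]

variable {m : Fin 3 → ℝ} {α β : ℝ} {b : Reduced m}

/-- The orbit of a Lagrange triangle is a nondegenerate critical manifold of the action on a space
`Y` of paths, provided that the Fourier modes of `Y` are not resonant. -/
theorem IsLagrangeTriangle.isCriticalWithHessianKernel (hb : IsLagrangeTriangle m α b)
    (hm : ∀ k, 0 < m k) (hα : 1 ≤ α)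
    (hβ : β = 27 * (m 0 * m 1 + m 0 * m 2 + m 1 * m 2) / (m 0 + m 1 + m 2) ^ 2)
    (hαβ : 9 * ((3 - α) / (1 + α)) ^ 2 < β) {p : ℤ} (hp : p ≠ 0)
    {Y : Type*} [NormedAddCommGroup Y] [NormedSpace ℝ Y] (ι : Y →L[ℝ] H1 (Reduced m))
    (hι : Function.Injective ι) {y j : Y} (hy : ι y = constPath b)
    (hj : ι j = constPath (mul Complex.I b)) (modes : Set ℤ) (h0 : 0 ∈ modes)
    (hmodes : ∀ n ∈ modes, ∀ (w : Reduced m) (v : H1 (Reduced m)),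
      (path v =ᵐ[volume] (fun s => cosS n s • w) ∨ path v =ᵐ[volume] fun s => sinS n s • w) →
        v ∈ Set.range ι)
    (hres : ∀ n ∈ modes, n ≠ 0 → ((n : ℝ) / p) ^ 2 ≠ 3 - α)
    (hvan : ∀ n, n ∉ modes → ∀ (u : Y) (k : Fin 3),
      fourierCoeff (fun s => positionL m k (path (ι u) s)) n = 0) :
    IsCriticalWithHessianKernel (fun u => action m α p (ι u)) y (Submodule.span ℝ {j}) := by
  obtain ⟨d, hd, hbd⟩ := hb.2
  obtain ⟨U', B, hU, hU', hJ, hB⟩ := hb.hasHessianAt_potential hm hd hbd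
  obtain ⟨A', H, hA, hA', hH⟩ := hasHessianAt_action α p b hU
  rw [← hy] at hA
  have hY := hA.comp_clm ι
  have int1 : ∀ (L : PiLp 2 (fun _ : Fin 3 => ℂ) →L[ℝ] ℝ) (v : H1 (Reduced m)),
      ∫ s, L (path v s).config = L (∫ s, path v s : Reduced m).config := fun L v =>
    (L.comp (configL m)).integral_comp_comm (integrable_path v)
  have crit : ∀ v, A' v = 0 := by
    intro v
    rw [hA', int1, ← hU' (∫ s, path v s)]
    congr 1
    refine Finset.sum_congr rfl fun k _ => ?_
    rw [real_inner_comm, inner_inertialVelocity_constPath, positionL_apply]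
  have Jker : ∀ v, H (constPath (mul Complex.I b)) v = 0 := by
    intro v
    have e : ∫ s, B (path (constPath (mul Complex.I b)) s).config (path v s).config =
        B (mul Complex.I b).config (∫ s, path v s : Reduced m).config := by
      rw [← int1]
      refine integral_congr_ae ?_
      filter_upwards [path_constPath (mul Complex.I b)] with s hs
      rw [hs]
    rw [hH, e, ← hJ (∫ s, path v s)]
    congr 1
    refine Finset.sum_congr rfl fun k _ => ?_
    rw [real_inner_comm, inner_inertialVelocity_constPath, positionL_apply]
  have hp' : (p : ℂ) ≠ 0 := by exact_mod_cast hp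
  have mode : ∀ n ∈ modes, ∀ u : H1 (Reduced m), (∀ v, H u (ι v) = 0) →
      (n ≠ 0 → ∫ s, cosS n s • path u s = 0 ∧ ∫ s, sinS n s • path u s = 0) ∧
        (n = 0 → ∃ r : ℝ, ∫ s, cosS n s • path u s = r • mul Complex.I b) := by
    intro n hn u hu
    have key := IsLagrangeTriangle.mode_eq (ν := (n : ℝ) / p) (c := ∫ s, cosS n s • path u s)
      (s := ∫ s, sinS n s • path u s) hm hα hβ hαβ hd hbd hB ?_ ?_
    · refine ⟨fun hn0 => key.1 (div_ne_zero (by exact_mod_cast hn0) (by exact_mod_cast hp))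
        (hres n hn hn0), fun hn0 => key.2 (by rw [hn0]; simp)⟩
    · intro w
      obtain ⟨v, hv, hv'⟩ := exists_smul_const w (contDiff_cosS n) (ψ := fun s => -n * sinS n s)
        (hasDerivAt_cosS n)
      obtain ⟨v, rfl⟩ := hmodes n hn w v (Or.inl hv)
      rw [← hu v, hH, integral_bilinear_path B u (ι v) w (continuous_cosS n) hv]
      congr 1
      refine Finset.sum_congr rfl fun k _ => ?_
      rw [inner_inertialVelocity p k u (ι v) w (contDiff_cosS n)
        (contDiff_const.mul (contDiff_sinS n)) (hasDerivAt_cosS n)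
        (χ := fun s => -n * (n * cosS n s)) (fun t => (hasDerivAt_sinS n t).const_mul _) hv hv']
      simp only [mul_smul, integral_smul, map_smul, Complex.real_smul, positionL_apply]
      congr 2
      push_cast
      field_simp
      ring
    · intro w
      obtain ⟨v, hv, hv'⟩ := exists_smul_const w (contDiff_sinS n) (ψ := fun s => n * cosS n s)
        (hasDerivAt_sinS n)
      obtain ⟨v, rfl⟩ := hmodes n hn w v (Or.inr hv)
      rw [← hu v, hH, integral_bilinear_path B u (ι v) w (continuous_sinS n) hv]
      congr 1
      refine Finset.sum_congr rfl fun k _ => ?_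
      rw [inner_inertialVelocity p k u (ι v) w (contDiff_sinS n)
        (contDiff_const.mul (contDiff_cosS n)) (hasDerivAt_sinS n)
        (χ := fun s => n * (-n * sinS n s)) (fun t => (hasDerivAt_cosS n t).const_mul _) hv hv']
      simp only [mul_smul, integral_smul, map_smul, Complex.real_smul, positionL_apply]
      congr 2
      push_cast
      field_simp
      ring
  refine ⟨hY.contDiffAt, ?_, ?_⟩
  · rw [hY.fderiv_eq]
    ext v
    exact crit (ι v)
  · rw [hY.fderiv_fderiv_eq]
    ext u
    rw [LinearMap.mem_ker, Submodule.mem_span_singleton]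
    constructor
    · intro hu
      have hu' : ∀ v, H (ι u) (ι v) = 0 := fun v => congrArg (fun L : Y →L[ℝ] ℝ => L v) hu
      obtain ⟨r, hr⟩ := (mode 0 h0 (ι u) hu').2 rfl
      simp only [cosS_zero, one_smul] at hr
      -- The factor `2π` is the length of the circle: `r` describes the integral of the path, not
      -- its mean. Subtracting this multiple of `j` leaves a kernel element `x` with mean zero, all
      -- of whose Fourier coefficients vanish.
      refine ⟨r / (2 * π), hι (sub_eq_zero.1 ?_)⟩
      rw [← map_sub]
      obtain ⟨x, hx⟩ : ∃ x, x = (r / (2 * π)) • j - u := ⟨_, rfl⟩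
      rw [← hx]
      have hxker : ∀ v, H (ι x) (ι v) = 0 := by
        intro v
        rw [hx, map_sub, map_smul, hj, map_sub, map_smul, sub_apply, smul_apply, hu', Jker,
          smul_zero, sub_zero]
      have hx0 : ∫ s, path (ι x) s = 0 := by
        have e : path (ι x) =ᵐ[volume]
            fun s => (r / (2 * π)) • path (constPath (mul Complex.I b)) s - path (ι u) s := by
          rw [hx, map_sub, map_smul, hj]
          have e1 := Lp.coeFn_sub ((r / (2 * π)) • pathL _ (constPath (mul Complex.I b)))
            (pathL _ (ι u))
          have e2 := Lp.coeFn_smul (r / (2 * π)) (pathL _ (constPath (mul Complex.I b)))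
          filter_upwards [e1, e2] with s h1 h2
          refine h1.trans ?_
          rw [Pi.sub_apply, h2]
          rfl
        rw [integral_congr_ae e, integral_sub ((integrable_path _).fun_smul _) (integrable_path _),
          integral_smul, integral_path_constPath, hr, smul_smul,
          div_mul_cancel₀ _ Real.two_pi_pos.ne', sub_self]
      refine eq_zero_of_fourierCoeff fun k n => ?_
      by_cases hn : n ∈ modes
      · rw [fourierCoeff_clm_comp (integrable_path _)]
        by_cases hn0 : n = 0
        · subst hn0
          simp only [cosS_zero, sinS_zero, one_smul, zero_smul, integral_zero, hx0, map_zero,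
            mul_zero, sub_zero, smul_zero]
        · obtain ⟨h1, h2⟩ := (mode n hn (ι x) hxker).1 hn0
          rw [h1, h2, map_zero, mul_zero, sub_zero, smul_zero]
      · exact hvan n hn x k
    · rintro ⟨r, rfl⟩
      ext v
      change H (ι (r • j)) (ι v) = 0
      rw [map_smul, hj, map_smul, smul_apply, Jker, smul_zero]

end NBody

end

/-! ### Exclusion of the resonances in the two cases -/

theorem mainTheorem5 (m : Fin 3 → ℝ) (hm : ∀ k, 0 < m k) (β : ℝ)
    (hβ : β = 27 * (m 0 * m 1 + m 0 * m 2 + m 1 * m 2) / (m 0 + m 1 + m 2) ^ 2) :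
    (∀ α : ℝ, 1 ≤ α → α ≠ 2 → 9 * ((3 - α) / (1 + α)) ^ 2 < β →
      ∀ p : ℤ, p ≠ 0 →
        (α < 3 → ∀ l : ℕ, |(p : ℝ)| ≠ (3 - α) ^ (-(1 / 2) : ℝ) * l) →
        ∀ a : NBody.Reduced m, NBody.IsLagrangeTriangle m α a →
          NBody.IsTwoPiNondegenerate m α p a) ∧
    (1 < β → ∀ l : ℕ, 1 < l →
      ∀ a : NBody.Reduced m, NBody.IsLagrangeTriangle m 2 a →
        NBody.IsTwoPiDivNondegenerate m 2 l a) := by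
  constructor
  · intro α hα _ hαβ p hp hres a ha θ b hb
    subst hb
    refine (ha.rotate θ).isCriticalWithHessianKernel hm hα hβ hαβ hp
      (ContinuousLinearMap.id ℝ _) Function.injective_id rfl rfl Set.univ (Set.mem_univ _)
      (fun _ _ _ v _ => ⟨v, rfl⟩) (fun n _ hn h => ?_) (fun n hn => absurd (Set.mem_univ n) hn)
    have hp' : (p : ℝ) ≠ 0 := by exact_mod_cast hp
    have hn' : (n : ℝ) ≠ 0 := by exact_mod_cast hn
    -- A resonance equates `3 - α` with a nonzero square, so `α < 3` and the condition on `p` is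
    -- available; it is violated by the natural number `|n|`.
    have hpos : 0 < 3 - α := by
      rw [← h]
      positivity
    refine hres (by linarith) n.natAbs ?_
    have h1 : (3 - α) ^ (1 / 2 : ℝ) = |(n : ℝ)| / |(p : ℝ)| := by
      rw [← Real.sqrt_eq_rpow, ← h, Real.sqrt_sq_eq_abs, abs_div]
    rw [Real.rpow_neg hpos.le, h1, Nat.cast_natAbs, Int.cast_abs]
    have h2 : |(p : ℝ)| ≠ 0 := abs_ne_zero.2 hp'
    have h3 : |(n : ℝ)| ≠ 0 := abs_ne_zero.2 hn'
    field_simp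
  · intro h1 l hl a ha θ b hb
    subst hb
    have hl0 : l ≠ 0 := by omega
    refine (ha.rotate θ).isCriticalWithHessianKernel hm one_le_two hβ
      (by norm_num; exact h1) one_ne_zero
      (Sobolev.H1periodic (NBody.Reduced m) l).subtypeL Subtype.val_injective rfl rfl
      {n | (l : ℤ) ∣ n} (dvd_zero _) (fun n hn w v hv => ?_) (fun n hn hn0 h => ?_)
      (fun n hn u k => ?_)
    · have hper : ∀ s, fourier n (s + ((2 * π / l : ℝ) : Sobolev.S1)) = fourier n s := by
        intro s
        have e := (Sobolev.fourier_two_pi_div_eq_one_iff hl0 n).2 hn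
        rw [fourier_apply] at e
        rw [fourier_apply, fourier_apply, smul_add, AddCircle.toCircle_add, Circle.coe_mul, e,
          mul_one]
      refine ⟨⟨v, ?_⟩, rfl⟩
      change (fun s => Sobolev.path v (s + ((2 * π / l : ℝ) : Sobolev.S1))) =ᵐ[volume]
        Sobolev.path v
      have shift := fun {f : Sobolev.S1 → NBody.Reduced m} (h : Sobolev.path v =ᵐ[volume] f) =>
        (measurePreserving_add_right (volume : Measure Sobolev.S1)
          ((2 * π / l : ℝ) : Sobolev.S1)).quasiMeasurePreserving.ae_eq_comp h
      rcases hv with hv | hv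
      · refine (shift hv).trans (EventuallyEq.trans ?_ hv.symm)
        refine ae_of_all _ fun s => ?_
        simp only [Function.comp_apply, Sobolev.cosS, hper]
      · refine (shift hv).trans (EventuallyEq.trans ?_ hv.symm)
        refine ae_of_all _ fun s => ?_
        simp only [Function.comp_apply, Sobolev.sinS, hper]
    · obtain ⟨k, rfl⟩ := hn
      -- With `α = 2` and `p = 1` a resonant frequency has square 1, so `l` would divide 1.
      have h2 : ((l : ℤ) * k) ^ 2 = 1 := by
        have : (((l : ℤ) * k : ℤ) : ℝ) ^ 2 = 1 := by
          rw [Int.cast_one, div_one] at h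
          linarith
        exact_mod_cast this
      have h3 : (l : ℤ) ∣ 1 := ⟨k * (l * k), by linear_combination -h2⟩
      have h4 := Int.le_of_dvd one_pos h3
      omega
    · refine Sobolev.fourierCoeff_eq_zero_of_periodic (h := ((2 * π / l : ℝ) : Sobolev.S1)) ?_ ?_
      · have hu : (fun s => Sobolev.path u.1 (s + ((2 * π / l : ℝ) : Sobolev.S1))) =ᵐ[volume]
          Sobolev.path u.1 := u.2
        filter_upwards [hu] with s hs
        exact congrArg (NBody.positionL m k) hs
      · rw [Ne, Sobolev.fourier_two_pi_div_eq_one_iff hl0, dvd_neg]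
        exact hn
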